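/- Let $X=[a,b]\subset\mathbb R$ with $a<b$, let $0<\alpha\le 1$, let $m\ge 1$ be an integer and let $0<\beta<\rho<1$. A $C^{1+\alpha}$ *conformal IFS* on $X$ is a tuple $\mathcal S=(S_1,\dots,S_m)$ of maps $S_i:X\to X$ for which there is an open interval $V\supset X$ such that every $S_i$ extends to an injective, continuously differentiable map $S_i:V\to V$ whose derivative does not vanish, is Hölder continuous with exponent $\alpha$, and satisfies $\sup_V|S_i'|<1$. Let $\Theta^m_{\beta,\rho}(X)$ be the set of those with $\beta\le|S_i'(x)|\le\rho$ for all $x\in X$ and all $i$, with the metric $$\mathrm{dist}(\mathcal T,\mathcal G)=\max_{i}\|T_i-G_i\|,\qquad \|h\|=\sup_X|h|+\sup_X|h'|+\sup_{x\ne y\in X}\frac{|h'(x)-h'(y)|}{|x-y|^{\alpha}} .$$ The attractor of $\mathcal S$ is the unique non-empty compact set $\Lambda$ with $\Lambda=\bigcup_i S_i(\Lambda)$. For a finite word $w=w_1\cdots w_n$ over $\{1,\dots,m\}$ put $S_w=S_{w_1}\circ\cdots\circ S_{w_n}$, let $S_\emptyset$ be the identity, and let $w^-$ be $w$ without its last letter.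 Say that * $\mathcal S$ satisfies the *SSP* if $S_i(\Lambda)\cap S_j(\Lambda)=\emptyset$ for all $i\ne j$; * $\mathcal S$ has an *exact overlap* if $S_u|_\Lambda=S_v|_\Lambda$ for some non-empty finite words $u\neq v$; * $\mathcal S$ satisfies the *WSP* if $\sup\{\#\Phi(x,r): x\in\Lambda,\ r>0\}<\infty$, where $\Phi(x,r)$ is the set of the maps $S_w|_\Lambda$ with $w$ a non-empty finite word, $\mathrm{diam}\,S_w(\Lambda)\le r<\mathrm{diam}\,S_{w^-}(\Lambda)$ and $S_w(\Lambda)\cap B(x,r)\ne\emptyset$. Then the set of all $\mathcal S\in\Theta^m_{\beta,\rho}(X)$ for which it is *not* true that either the SSP holds, or the WSP fails and there are no exact overlaps, is of first category (meagre) in $\Theta^m_{\beta,\rho}(X)$. -/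

import Mathlib

open Set

noncomputable section

namespace SelfConformal

/-- A map `T` is a `C^{1+α}` conformal mapping on the open set `V`: it is continuously
differentiable, its derivative is Hölder continuous of exponent `α`, and the derivative does not
vanish. -/
def IsConformalMap (α : ℝ) (V : Set ℝ) (T : ℝ → ℝ) : Prop :=
  ContDiffOn ℝ 1 T V ∧
  (∃ C : ℝ, ∀ x ∈ V, ∀ y ∈ V, |deriv T x - deriv T y| ≤ C * |x - y| ^ α) ∧
  ∀ x ∈ V, deriv T x ≠ 0

/-- `S = (S₁, …, S_m)` is a conformal IFS (of class `C^{1+α}`) on the compact interval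
`X = [a, b]`: every `S i : X → X` extends to an injective conformal mapping `V → V` of an open
interval `V ⊇ X`, with `sup_V |S i'| < 1`. -/
def IsConformalIFS {a b : ℝ} {m : ℕ} (α : ℝ) (S : Fin m → Icc a b → Icc a b) : Prop :=
  ∃ V : Set ℝ, IsOpen V ∧ V.OrdConnected ∧ Icc a b ⊆ V ∧
    ∀ i, ∃ T : ℝ → ℝ, (∀ x : Icc a b, T x = S i x) ∧ IsConformalMap α V T ∧
      InjOn T V ∧ MapsTo T V V ∧ ∃ c : ℝ, c < 1 ∧ ∀ x ∈ V, |deriv T x| ≤ c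

/-- The derivative of a function on `X = [a, b]` (one-sided at the end points). -/
def derivX {a b : ℝ} (h : Icc a b → ℝ) (x : Icc a b) : ℝ :=
  derivWithin (Function.extend Subtype.val h 0) (Icc a b) x

/-- The `C^{1+α}` norm
`sup |h| + sup |h'| + sup_{x, y} |h' x - h' y| / |x - y| ^ α` over `X = [a, b]`. The pairs with
`x = y` contribute `0 / 0 = 0`. -/
def holderNorm {a b : ℝ} (α : ℝ) (h : Icc a b → ℝ) : ℝ :=
  (⨆ x, |h x|) + (⨆ x, |derivX h x|) +
    ⨆ p : Icc a b × Icc a b, |derivX h p.1 - derivX h p.2| / |(p.1 : ℝ) - p.2| ^ α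

/-- The space `Θ^m_{β,ρ}(X)`, `X = [a, b]`, of conformal IFSs of `m` maps of class `C^{1+α}` on
`X` with `β ≤ |S i'| ≤ ρ` on `X`. -/
@[ext]
structure Theta (a b α β ρ : ℝ) (m : ℕ) where
  map : Fin m → Icc a b → Icc a b
  conformal : IsConformalIFS α map
  bounds : ∀ i x, β ≤ |derivX (fun y => (map i y : ℝ)) x| ∧
    |derivX (fun y => (map i y : ℝ)) x| ≤ ρ

namespace Theta

variable {a b α β ρ : ℝ} {m : ℕ}

/-- The difference `T i - G i` as a real function on `X`. -/
def diff (T G : Theta a b α β ρ m) (i : Fin m) (x : Icc a b) : ℝ := T.map i x - G.map i x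

theorem differentiable_map (T : Theta a b α β ρ m) (i : Fin m) (x : Icc a b) :
    DifferentiableWithinAt ℝ (Function.extend Subtype.val (fun y => (T.map i y : ℝ)) 0)
      (Icc a b) x := by
  obtain ⟨V, hV, -, hXV, h⟩ := T.conformal
  obtain ⟨f, hf, ⟨hc, -, -⟩, -⟩ := h i
  have h1 : DifferentiableWithinAt ℝ f (Icc a b) x :=
    ((hc.differentiableOn one_ne_zero) x (hXV x.2)).mono hXV
  refine h1.congr (fun y hy => ?_) ?_
  · exact (Subtype.val_injective.extend_apply _ _ (⟨y, hy⟩ : Icc a b)).trans (hf ⟨y, hy⟩).symm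
  · exact (Subtype.val_injective.extend_apply _ _ x).trans (hf x).symm

theorem derivX_diff (T G : Theta a b α β ρ m) (i : Fin m) (x : Icc a b) :
    derivX (T.diff G i) x =
      derivX (fun y => (T.map i y : ℝ)) x - derivX (fun y => (G.map i y : ℝ)) x := by
  unfold derivX
  rw [← derivWithin_sub (T.differentiable_map i x) (G.differentiable_map i x)]
  have key : ∀ y : Icc a b, Function.extend Subtype.val (T.diff G i) 0 (y : ℝ) =
      (Function.extend Subtype.val (fun y => (T.map i y : ℝ)) 0 -
        Function.extend Subtype.val (fun y => (G.map i y : ℝ)) 0) (y : ℝ) := by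
    intro y
    simp only [Pi.sub_apply, Subtype.val_injective.extend_apply, diff]
  exact derivWithin_congr (fun y hy => key ⟨y, hy⟩) (key x)

theorem holder_map (T : Theta a b α β ρ m) (i : Fin m) :
    ∃ C : ℝ, ∀ x y : Icc a b, |derivX (fun y => (T.map i y : ℝ)) x -
      derivX (fun y => (T.map i y : ℝ)) y| ≤ C * |(x : ℝ) - y| ^ α := by
  obtain ⟨V, hV, -, hXV, h⟩ := T.conformal
  obtain ⟨f, hf, ⟨hc, ⟨C, hC⟩, -⟩, -⟩ := h i
  rcases lt_or_ge a b with hab | hab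
  · have key : ∀ x : Icc a b, derivX (fun y => (T.map i y : ℝ)) x = deriv f x := by
      intro x
      have hd : DifferentiableAt ℝ f x :=
        ((hc.differentiableOn one_ne_zero) x (hXV x.2)).differentiableAt (hV.mem_nhds (hXV x.2))
      rw [← hd.derivWithin (uniqueDiffOn_Icc hab x x.2)]
      refine derivWithin_congr (fun y hy => ?_) ?_
      · exact (Subtype.val_injective.extend_apply _ _ (⟨y, hy⟩ : Icc a b)).trans
          (hf ⟨y, hy⟩).symm
      · exact (Subtype.val_injective.extend_apply _ _ x).trans (hf x).symm
    exact ⟨C, fun x y => by rw [key, key]; exact hC x (hXV x.2) y (hXV y.2)⟩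
  · refine ⟨0, fun x y => ?_⟩
    have : x = y := Subtype.ext (by
      have := x.2.1; have := x.2.2; have := y.2.1; have := y.2.2; linarith)
    subst this
    simp

theorem bdd_diff (T G : Theta a b α β ρ m) (i : Fin m) :
    BddAbove (range fun x => |T.diff G i x|) := by
  refine ⟨b - a, ?_⟩
  rintro _ ⟨x, rfl⟩
  have h1 := (T.map i x).2
  have h2 := (G.map i x).2
  simp only [diff]
  rw [abs_le]
  constructor <;> linarith [h1.1, h1.2, h2.1, h2.2]

theorem bdd_derivX_diff (T G : Theta a b α β ρ m) (i : Fin m) :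
    BddAbove (range fun x => |derivX (T.diff G i) x|) := by
  refine ⟨ρ + ρ, ?_⟩
  rintro _ ⟨x, rfl⟩
  simp only [derivX_diff]
  exact (abs_sub _ _).trans (add_le_add (T.bounds i x).2 (G.bounds i x).2)

theorem bdd_holder_diff (T G : Theta a b α β ρ m) (i : Fin m) :
    BddAbove (range fun p : Icc a b × Icc a b =>
      |derivX (T.diff G i) p.1 - derivX (T.diff G i) p.2| / |(p.1 : ℝ) - p.2| ^ α) := by
  obtain ⟨C, hC⟩ := T.holder_map i
  obtain ⟨D, hD⟩ := G.holder_map i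
  refine ⟨max 0 (C + D), ?_⟩
  rintro _ ⟨⟨x, y⟩, rfl⟩
  dsimp only
  by_cases hxy : x = y
  · subst hxy; simp
  · have hpos : 0 < |(x : ℝ) - y| ^ α :=
      Real.rpow_pos_of_pos (abs_pos.2 (sub_ne_zero.2 fun h => hxy (Subtype.ext h))) _
    refine le_max_of_le_right ?_
    rw [div_le_iff₀ hpos, derivX_diff, derivX_diff, add_mul]
    refine le_trans (le_of_eq ?_) ((abs_sub _ _).trans (add_le_add (hC x y) (hD x y)))
    congr 1
    ring

theorem holderNorm_nonneg (h : Icc a b → ℝ) : 0 ≤ holderNorm α h := by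
  unfold holderNorm
  have h1 : 0 ≤ ⨆ x, |h x| := Real.iSup_nonneg fun x => abs_nonneg _
  have h2 : 0 ≤ ⨆ x, |derivX h x| := Real.iSup_nonneg fun x => abs_nonneg _
  have h3 : 0 ≤ ⨆ p : Icc a b × Icc a b,
      |derivX h p.1 - derivX h p.2| / |(p.1 : ℝ) - p.2| ^ α :=
    Real.iSup_nonneg fun p => div_nonneg (abs_nonneg _) (Real.rpow_nonneg (abs_nonneg _) _)
  linarith

theorem holderNorm_diff_comm (T G : Theta a b α β ρ m) (i : Fin m) :
    holderNorm α (T.diff G i) = holderNorm α (G.diff T i) := by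
  have h0 : ∀ x, |T.diff G i x| = |G.diff T i x| := fun x => abs_sub_comm _ _
  have h1 : ∀ x, |derivX (T.diff G i) x| = |derivX (G.diff T i) x| := fun x => by
    rw [derivX_diff, derivX_diff, abs_sub_comm]
  have h2 : ∀ x y, |derivX (T.diff G i) x - derivX (T.diff G i) y| =
      |derivX (G.diff T i) x - derivX (G.diff T i) y| := fun x y => by
    simp only [derivX_diff]
    rw [← abs_neg]
    congr 1
    ring
  simp only [holderNorm, h0, h1, h2]

theorem holderNorm_diff_triangle (T G H : Theta a b α β ρ m) (i : Fin m) :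
    holderNorm α (T.diff H i) ≤ holderNorm α (T.diff G i) + holderNorm α (G.diff H i) := by
  by_cases hX : Nonempty (Icc a b)
  · have h1 : (⨆ x, |T.diff H i x|) ≤ (⨆ x, |T.diff G i x|) + ⨆ x, |G.diff H i x| :=
      ciSup_le fun x => le_trans (abs_sub_le _ _ _)
        (add_le_add (le_ciSup (T.bdd_diff G i) x) (le_ciSup (G.bdd_diff H i) x))
    have h2 : (⨆ x, |derivX (T.diff H i) x|) ≤
        (⨆ x, |derivX (T.diff G i) x|) + ⨆ x, |derivX (G.diff H i) x| := by
      refine ciSup_le fun x => le_trans ?_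
        (add_le_add (le_ciSup (T.bdd_derivX_diff G i) x) (le_ciSup (G.bdd_derivX_diff H i) x))
      simp only [derivX_diff]
      exact abs_sub_le _ _ _
    have h3 : (⨆ p : Icc a b × Icc a b,
          |derivX (T.diff H i) p.1 - derivX (T.diff H i) p.2| / |(p.1 : ℝ) - p.2| ^ α) ≤
        (⨆ p : Icc a b × Icc a b,
          |derivX (T.diff G i) p.1 - derivX (T.diff G i) p.2| / |(p.1 : ℝ) - p.2| ^ α) +
        ⨆ p : Icc a b × Icc a b,
          |derivX (G.diff H i) p.1 - derivX (G.diff H i) p.2| / |(p.1 : ℝ) - p.2| ^ α := by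
      refine ciSup_le fun p => le_trans ?_
        (add_le_add (le_ciSup (T.bdd_holder_diff G i) p) (le_ciSup (G.bdd_holder_diff H i) p))
      rw [← add_div]
      refine div_le_div_of_nonneg_right ?_ (Real.rpow_nonneg (abs_nonneg _) _)
      simp only [derivX_diff]
      refine le_trans (le_of_eq ?_) (abs_add_le _ _)
      congr 1
      ring
    unfold holderNorm
    linarith
  · have : IsEmpty (Icc a b) := not_nonempty_iff.1 hX
    simp [holderNorm, Real.iSup_of_isEmpty]

/-- `Θ^m_{β,ρ}(X)` with the metric `dist (T, G) = max_i ‖T i - G i‖`, where `‖·‖` is the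
`C^{1+α}` norm on `X`. -/
instance : MetricSpace (Theta a b α β ρ m) where
  dist T G := ⨆ i, holderNorm α (T.diff G i)
  dist_self T := by
    have h0 : ∀ i x, T.diff T i x = 0 := fun i x => sub_self _
    have h1 : ∀ i x, derivX (T.diff T i) x = 0 := fun i x => by rw [derivX_diff, sub_self]
    simp [holderNorm, h0, h1]
  dist_comm T G := by simp only [T.holderNorm_diff_comm G]
  dist_triangle T G H := by
    rcases isEmpty_or_nonempty (Fin m) with h | h
    · simp [Real.iSup_of_isEmpty]
    · exact ciSup_le fun i => (T.holderNorm_diff_triangle G H i).trans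
        (add_le_add (le_ciSup (f := fun i => holderNorm α (T.diff G i)) (finite_range _).bddAbove i)
          (le_ciSup (f := fun i => holderNorm α (G.diff H i)) (finite_range _).bddAbove i))
  eq_of_dist_eq_zero := by
    intro T G h
    change (⨆ i, holderNorm α (T.diff G i)) = 0 at h
    apply Theta.ext
    funext i x
    have h1 : holderNorm α (T.diff G i) ≤ 0 := h ▸
      le_ciSup (f := fun i => holderNorm α (T.diff G i)) (finite_range _).bddAbove i
    have h2 : |T.diff G i x| ≤ ⨆ x, |T.diff G i x| := le_ciSup (T.bdd_diff G i) x
    have h3 : 0 ≤ ⨆ x, |derivX (T.diff G i) x| := Real.iSup_nonneg fun x => abs_nonneg _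
    have h4 : 0 ≤ ⨆ p : Icc a b × Icc a b,
        |derivX (T.diff G i) p.1 - derivX (T.diff G i) p.2| / |(p.1 : ℝ) - p.2| ^ α :=
      Real.iSup_nonneg fun p => div_nonneg (abs_nonneg _) (Real.rpow_nonneg (abs_nonneg _) _)
    unfold holderNorm at h1
    have h5 : |T.diff G i x| ≤ 0 := by linarith
    have h6 : T.diff G i x = 0 := abs_nonpos_iff.1 h5
    exact Subtype.ext (sub_eq_zero.1 h6)

/-- `Λ` is an attractor of `S`: a non-empty compact set with `Λ = ⋃ᵢ Sᵢ(Λ)`. -/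
def IsAttractor (S : Theta a b α β ρ m) (L : Set (Icc a b)) : Prop :=
  L.Nonempty ∧ IsCompact L ∧ L = ⋃ i, S.map i '' L

theorem map_contracting (S : Theta a b α β ρ m) (i : Fin m) :
    ∃ c : NNReal, c < 1 ∧ LipschitzWith c (S.map i) := by
  obtain ⟨V, hV, hVc, hXV, h⟩ := S.conformal
  obtain ⟨f, hf, ⟨hc, -, -⟩, -, -, c, hc1, hcf⟩ := h i
  refine ⟨c.toNNReal, by simpa using hc1, ?_⟩
  have hL : LipschitzOnWith c.toNNReal f V := by
    refine hVc.convex.lipschitzOnWith_of_nnnorm_deriv_le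
      (fun x hx => ((hc.differentiableOn one_ne_zero) x hx).differentiableAt (hV.mem_nhds hx))
      fun x hx => ?_
    rw [← NNReal.coe_le_coe, coe_nnnorm, Real.norm_eq_abs]
    exact (hcf x hx).trans (Real.le_coe_toNNReal c)
  refine LipschitzWith.of_dist_le_mul fun x y => ?_
  have := hL.dist_le_mul x (hXV x.2) y (hXV y.2)
  rwa [hf, hf] at this

theorem map_injective (S : Theta a b α β ρ m) (i : Fin m) : Function.Injective (S.map i) := by
  obtain ⟨V, hV, hVc, hXV, h⟩ := S.conformal
  obtain ⟨f, hf, -, hinj, -⟩ := h i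
  intro x y hxy
  refine Subtype.ext (hinj (hXV x.2) (hXV y.2) ?_)
  rw [hf, hf, hxy]

theorem IsAttractor.subset {S : Theta a b α β ρ m} {K L : Set (Icc a b)}
    (hK : S.IsAttractor K) (hL : S.IsAttractor L) : K ⊆ L := by
  obtain ⟨x, hx, hmax⟩ := hK.2.1.exists_isMaxOn hK.1
    (Metric.continuous_infDist_pt L).continuousOn
  have hx' := hx
  rw [hK.2.2] at hx'
  obtain ⟨i, y, hy, rfl⟩ := mem_iUnion.1 hx'
  obtain ⟨c, hc1, hc⟩ := S.map_contracting i
  obtain ⟨z, hz, hyz⟩ := hL.2.1.exists_infDist_eq_dist hL.1 y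
  have hz' : S.map i z ∈ L := by
    rw [hL.2.2]; exact mem_iUnion.2 ⟨i, z, hz, rfl⟩
  have h1 : Metric.infDist (S.map i y) L ≤ c * Metric.infDist y L := by
    rw [hyz]; exact (Metric.infDist_le_dist_of_mem hz').trans (hc.dist_le_mul y z)
  have h2 : Metric.infDist y L ≤ Metric.infDist (S.map i y) L := hmax hy
  have hc1' : (c : ℝ) < 1 := hc1
  have h0 : Metric.infDist (S.map i y) L ≤ 0 := by
    have := Metric.infDist_nonneg (x := S.map i y) (s := L)
    have := Metric.infDist_nonneg (x := y) (s := L)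
    nlinarith [c.2]
  intro w hw
  have hw0 : Metric.infDist w L = 0 :=
    le_antisymm ((show _ ≤ Metric.infDist (S.map i y) L from hmax hw).trans h0)
      Metric.infDist_nonneg
  exact (hL.2.1.isClosed.mem_iff_infDist_zero hL.1).2 hw0

/-- Existence and uniqueness of the attractor. -/
theorem existsUnique_attractor (hab : a ≤ b) (hm : 1 ≤ m) (S : Theta a b α β ρ m) :
    ∃! L, S.IsAttractor L := by
  let F : Set (Icc a b) → Set (Icc a b) := fun A => ⋃ i, S.map i '' A
  have hF : Monotone F := fun A B h => iUnion_mono fun i => image_mono h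
  let K : ℕ → Set (Icc a b) := fun n => F^[n] univ
  have hKs : ∀ n, K (n + 1) = F (K n) := fun n => Function.iterate_succ_apply' F n univ
  have hanti : ∀ n, K (n + 1) ⊆ K n := by
    intro n
    induction n with
    | zero => exact subset_univ _
    | succ n ih =>
      rw [hKs (n + 1)]
      conv_rhs => rw [hKs n]
      exact hF ih
  have hcont : ∀ i, Continuous (S.map i) := fun i =>
    let ⟨_, _, hc⟩ := S.map_contracting i
    hc.continuous
  have hcpt : ∀ n, IsCompact (K n) := by
    intro n
    induction n with
    | zero => exact isCompact_univ
    | succ n ih => rw [hKs]; exact isCompact_iUnion fun i => ih.image (hcont i)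
  have hne : ∀ n, (K n).Nonempty := by
    intro n
    induction n with
    | zero => exact ⟨⟨a, left_mem_Icc.2 hab⟩, trivial⟩
    | succ n ih =>
      rw [hKs]
      obtain ⟨x, hx⟩ := ih
      exact ⟨_, mem_iUnion.2 ⟨⟨0, hm⟩, x, hx, rfl⟩⟩
  have hmono : Antitone K := antitone_nat_of_succ_le hanti
  suffices hsub : S.IsAttractor (⋂ n, K n) from
    ⟨_, hsub, fun L hL => Subset.antisymm (hL.subset hsub) (hsub.subset hL)⟩
  refine ⟨?_, ?_, ?_⟩
  · exact IsCompact.nonempty_iInter_of_sequence_nonempty_isCompact_isClosed K hanti hne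
      (hcpt 0) fun n => (hcpt n).isClosed
  · exact (isClosed_iInter fun n => (hcpt n).isClosed).isCompact
  · apply Subset.antisymm
    · intro x hx
      by_contra hcon
      have hcon' : ∀ i, ∃ n, x ∉ S.map i '' K n := by
        intro i
        by_contra! hi
        obtain ⟨y, -, hy⟩ := hi 0
        refine hcon (mem_iUnion.2 ⟨i, y, mem_iInter.2 fun n => ?_, hy⟩)
        obtain ⟨z, hz, hzx⟩ := hi n
        rwa [← S.map_injective i (hzx.trans hy.symm)]
      choose N hN using hcon'
      have hxN := mem_iInter.1 hx (Finset.univ.sup N + 1)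
      rw [hKs] at hxN
      obtain ⟨i, hi⟩ := mem_iUnion.1 hxN
      exact hN i (image_mono (hmono (Finset.le_sup (Finset.mem_univ i))) hi)
    · intro x hx
      obtain ⟨i, y, hy, rfl⟩ := mem_iUnion.1 hx
      refine mem_iInter.2 fun n => hanti n ?_
      rw [hKs]
      exact mem_iUnion.2 ⟨i, y, mem_iInter.1 hy n, rfl⟩

open Classical in
/-- The attractor `Λ` of `S`: the unique non-empty compact set with `Λ = ⋃ᵢ Sᵢ(Λ)`
(see `existsUnique_attractor`). -/
def attractor (S : Theta a b α β ρ m) : Set (Icc a b) :=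
  if h : ∃ L, S.IsAttractor L then h.choose else ∅

theorem isAttractor_attractor (hab : a ≤ b) (hm : 1 ≤ m) (S : Theta a b α β ρ m) :
    S.IsAttractor S.attractor := by
  have h := (existsUnique_attractor hab hm S).exists
  unfold attractor
  rw [dif_pos h]
  exact h.choose_spec

/-- `S_w = S_{w₁} ∘ ⋯ ∘ S_{w_n}` for a word `w = w₁ … w_n`; the empty word gives the identity. -/
def comp (S : Theta a b α β ρ m) : List (Fin m) → Icc a b → Icc a b
  | [] => id
  | i :: w => S.map i ∘ S.comp w

/-- `S` has an exact overlap: `S_u = S_v` on `Λ` for two distinct non-empty words `u`, `v`. -/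
def HasExactOverlap (S : Theta a b α β ρ m) : Prop :=
  ∃ u v : List (Fin m), u ≠ [] ∧ v ≠ [] ∧ u ≠ v ∧ EqOn (S.comp u) (S.comp v) S.attractor

/-- The Strong Separation Property. -/
def SSP (S : Theta a b α β ρ m) : Prop :=
  ∀ i j : Fin m, i ≠ j → (S.map i '' S.attractor) ∩ (S.map j '' S.attractor) = ∅

/-- The set `Φ(x, r)` of the restrictions `S_w|_Λ`, `w` a non-empty word, such that
`diam S_w(Λ) ≤ r < diam S_{w⁻}(Λ)` and `S_w(Λ)` meets the ball `B(x, r)`; here `w⁻` is `w` without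
its last letter. -/
def Phi (S : Theta a b α β ρ m) (x : Icc a b) (r : ℝ) : Set (S.attractor → Icc a b) :=
  {g | ∃ w : List (Fin m), w ≠ [] ∧ g = S.attractor.domRestrict (S.comp w) ∧
    Metric.diam (S.comp w '' S.attractor) ≤ r ∧
    r < Metric.diam (S.comp w.dropLast '' S.attractor) ∧
    ((S.comp w '' S.attractor) ∩ Metric.ball x r).Nonempty}

/-- The Weak Separation Property: `sup {#Φ(x, r) : x ∈ Λ, r > 0} < ∞`. -/
def WSP (S : Theta a b α β ρ m) : Prop :=
  ∃ N : ℕ, ∀ x ∈ S.attractor, ∀ r : ℝ, 0 < r → (S.Phi x r).encard ≤ N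

end Theta

end SelfConformal

end

/-!
Fix two letters `o ≠ l`. Among the elements of `Theta` those are open and dense for which the maps
`o` and `l` have different fixed points and the bounds on derivatives and values are strict
(`exists_open_regular`). Such an element may be perturbed by adding a small multiple of any `C²`
function to one of its maps, as the derivative of a map only has to be Hölder continuous and
bounded as required on `[a, b]` itself (`exists_of_hasDerivWithinAt`, `exists_isPerturbation`).

*Exact overlaps.* An overlap of two distinct words `u`, `v` forces `S_u = S_v` on the orbit of the
fixed point `p` of the map `o` under all words. This is a closed condition (`agreeSet`). It has no
interior: after removal of a common suffix of `u` and `v`, either some `S_t`, `t ≠ []`, fixes two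
distinct points, or the two words continue differently, by letters `i ≠ j`, from a point `x` of the
orbit that may be chosen not to be fixed by any short word. Adding to `S_i` a polynomial with
a simple zero at `x` and double zeros at the other points involved moves none of these points and
changes the derivative of only one of the two compositions. But `S_u` and `S_v` agree on a set that
accumulates at every one of its points, so their derivatives agree there as well: a contradiction
(`exists_comp_ne_of_letter_ne`, `isNowhereDense_agreeSet`).

*Weak separation.* Suppose that the strong separation property fails, so that a point `y` lies in
the pieces of two letters `i ≠ j`. There are two codings of `y`: one uses the letter `i` at
each visit of its orbit to `y`, the other one does so too except that it begins with `j`. The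
step by `j` onto `y` is then used exactly once, and adding a bump to `S_j` at the source of this
step moves one coded point across the other. By the intermediate value theorem, for some arbitrarily
small perturbation two words with different first letters have a common fixed point
(`exists_common_fixPt`, `exists_common_fixPt_of_not_SSP`). This point is coded by all
concatenations of the two words, so arbitrarily many words of equal scale have pieces near it, and
this persists in a neighbourhood (`manyWords_mem_nhds`). Without exact overlaps different words are
different maps, and so the weak separation property fails generically wherever strong separation
does (`isNowhereDense_not_SSP_diff`, `hasExactOverlap_of_WSP`).
-/

namespace SelfConformal

open Filter Topology

/-! ### Basic estimates and dynamics -/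

/-- The standing assumptions on the interval `[a, b]` and on the parameters `α`, `β`, `ρ`. -/
class Admissible (a b α β ρ : ℝ) : Prop where
  lt : a < b
  alpha_pos : 0 < α
  alpha_le_one : α ≤ 1
  beta_pos : 0 < β
  beta_lt_rho : β < ρ
  rho_lt_one : ρ < 1

/-- The extension by zero to `ℝ` of a function on `[a, b]`, the function that `derivX`
differentiates. -/
noncomputable def realExt {a b : ℝ} (h : Icc a b → ℝ) : ℝ → ℝ := Function.extend Subtype.val h 0

theorem realExt_apply {a b : ℝ} (h : Icc a b → ℝ) (x : Icc a b) : realExt h x = h x :=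
  Subtype.val_injective.extend_apply _ _ _

theorem derivX_eq {a b : ℝ} (hab : a < b) {h : Icc a b → ℝ} {x : Icc a b} {c : ℝ}
    (hc : HasDerivWithinAt (realExt h) c (Icc a b) x) : derivX h x = c :=
  hc.derivWithin (uniqueDiffOn_Icc hab x x.2)

theorem derivX_const_mul {a b : ℝ} (c : ℝ) (h : Icc a b → ℝ) (x : Icc a b) :
    derivX (fun y => c * h y) x = c * derivX h x := by
  have h1 : Function.extend Subtype.val (fun y => c * h y) 0 =
      fun s : ℝ => c * Function.extend Subtype.val h 0 s := by
    funext s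
    by_cases hs : ∃ y : Icc a b, (y : ℝ) = s
    · obtain ⟨y, rfl⟩ := hs
      simp only [Subtype.val_injective.extend_apply]
    · simp only [Function.extend_apply' _ _ _ hs, Pi.zero_apply, mul_zero]
  unfold derivX
  rw [h1, derivWithin_const_mul_field]

theorem holderNorm_const_mul {a b : ℝ} (α c : ℝ) (h : Icc a b → ℝ) :
    holderNorm α (fun y => c * h y) = |c| * holderNorm α h := by
  have h3 : ∀ p : Icc a b × Icc a b,
      |c * derivX h p.1 - c * derivX h p.2| / |(p.1 : ℝ) - p.2| ^ α =
        |c| * (|derivX h p.1 - derivX h p.2| / |(p.1 : ℝ) - p.2| ^ α) := fun p => by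
    rw [← mul_sub, abs_mul, mul_div_assoc]
  simp only [holderNorm, derivX_const_mul, h3, abs_mul]
  simp only [← Real.mul_iSup_of_nonneg (abs_nonneg c), mul_add]

theorem Admissible.rho_pos {a b α β ρ : ℝ} (h : Admissible a b α β ρ) : 0 < ρ :=
  h.beta_pos.trans h.beta_lt_rho

theorem Admissible.exists_pow_mul_le {a b α β ρ : ℝ} (h : Admissible a b α β ρ) (C : ℝ) {ε : ℝ}
    (hε : 0 < ε) : ∃ k : ℕ, ρ ^ k * C ≤ ε := by
  have h1 : Tendsto (fun k : ℕ => ρ ^ k * C) atTop (𝓝 0) := by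
    simpa using (tendsto_pow_atTop_nhds_zero_of_lt_one h.rho_pos.le h.rho_lt_one).mul_const C
  exact (h1.eventually (ge_mem_nhds hε)).exists

namespace Theta

variable {a b α β ρ : ℝ} {m : ℕ}

theorem holderNorm_diff_le_dist (T G : Theta a b α β ρ m) (i : Fin m) :
    holderNorm α (T.diff G i) ≤ dist T G :=
  le_ciSup (f := fun i => holderNorm α (T.diff G i)) (finite_range _).bddAbove i

theorem dist_le_of_holderNorm {T G : Theta a b α β ρ m} {C : ℝ} (hC : 0 ≤ C)
    (h : ∀ i, holderNorm α (T.diff G i) ≤ C) : dist T G ≤ C := Real.iSup_le h hC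

/-- The derivative of the `i`-th map. -/
noncomputable def mapDeriv (S : Theta a b α β ρ m) (i : Fin m) (x : Icc a b) : ℝ :=
  derivX (fun y => (S.map i y : ℝ)) x

theorem le_abs_mapDeriv (S : Theta a b α β ρ m) (i : Fin m) (x : Icc a b) :
    β ≤ |S.mapDeriv i x| := (S.bounds i x).1

theorem abs_mapDeriv_le (S : Theta a b α β ρ m) (i : Fin m) (x : Icc a b) :
    |S.mapDeriv i x| ≤ ρ := (S.bounds i x).2

theorem abs_map_sub_le_dist (T G : Theta a b α β ρ m) (i : Fin m) (x : Icc a b) :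
    |(T.map i x : ℝ) - G.map i x| ≤ dist T G := by
  refine le_trans ?_ (T.holderNorm_diff_le_dist G i)
  have h2 : |T.diff G i x| ≤ ⨆ x, |T.diff G i x| := le_ciSup (T.bdd_diff G i) x
  have h3 : 0 ≤ ⨆ x, |derivX (T.diff G i) x| := Real.iSup_nonneg fun x => abs_nonneg _
  have h4 : 0 ≤ ⨆ p : Icc a b × Icc a b,
      |derivX (T.diff G i) p.1 - derivX (T.diff G i) p.2| / |(p.1 : ℝ) - p.2| ^ α :=
    Real.iSup_nonneg fun p => div_nonneg (abs_nonneg _) (Real.rpow_nonneg (abs_nonneg _) _)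
  unfold holderNorm
  have h5 : T.diff G i x = (T.map i x : ℝ) - G.map i x := rfl
  rw [← h5]
  linarith

theorem abs_mapDeriv_sub_le_dist (T G : Theta a b α β ρ m) (i : Fin m) (x : Icc a b) :
    |T.mapDeriv i x - G.mapDeriv i x| ≤ dist T G := by
  refine le_trans ?_ (T.holderNorm_diff_le_dist G i)
  have h2 : |derivX (T.diff G i) x| ≤ ⨆ x, |derivX (T.diff G i) x| :=
    le_ciSup (T.bdd_derivX_diff G i) x
  have h3 : 0 ≤ ⨆ x, |T.diff G i x| := Real.iSup_nonneg fun x => abs_nonneg _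
  have h4 : 0 ≤ ⨆ p : Icc a b × Icc a b,
      |derivX (T.diff G i) p.1 - derivX (T.diff G i) p.2| / |(p.1 : ℝ) - p.2| ^ α :=
    Real.iSup_nonneg fun p => div_nonneg (abs_nonneg _) (Real.rpow_nonneg (abs_nonneg _) _)
  unfold holderNorm
  rw [derivX_diff] at h2
  change |T.mapDeriv i x - G.mapDeriv i x| ≤ _ at h2
  linarith

theorem hasDerivWithinAt_map (S : Theta a b α β ρ m) (i : Fin m) (x : Icc a b) :
    HasDerivWithinAt (realExt fun y => (S.map i y : ℝ)) (S.mapDeriv i x) (Icc a b) x :=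
  (S.differentiable_map i x).hasDerivWithinAt

/-- The mean value theorem for the maps of a conformal IFS. -/
theorem exists_map_sub_eq (S : Theta a b α β ρ m) (i : Fin m) (x y : Icc a b) :
    ∃ c, (S.map i x : ℝ) - S.map i y = S.mapDeriv i c * (x - y) := by
  wlog hxy : (y : ℝ) < x generalizing x y
  · rcases (not_lt.1 hxy).eq_or_lt with h | h
    · have : x = y := Subtype.ext h
      exact ⟨x, by simp [this]⟩
    · obtain ⟨c, hc⟩ := this y x h
      exact ⟨c, by linarith⟩
  set f := realExt fun y => (S.map i y : ℝ)
  have hsub : Icc (y : ℝ) x ⊆ Icc a b := Icc_subset_Icc y.2.1 x.2.2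
  have hcont : ContinuousOn f (Icc (y : ℝ) x) := fun z hz =>
    ((S.hasDerivWithinAt_map i ⟨z, hsub hz⟩).continuousWithinAt).mono hsub
  obtain ⟨c, hc, hd⟩ := exists_deriv_eq_slope f hxy hcont fun z hz =>
    ((S.differentiable_map i ⟨z, hsub (Ioo_subset_Icc_self hz)⟩).differentiableAt
      (Icc_mem_nhds (y.2.1.trans_lt hz.1) (hz.2.trans_le x.2.2))).differentiableWithinAt
  have hcm : c ∈ Icc a b := hsub (Ioo_subset_Icc_self hc)
  have h1 : deriv f c = S.mapDeriv i ⟨c, hcm⟩ :=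
    ((S.hasDerivWithinAt_map i ⟨c, hcm⟩).hasDerivAt
      (Icc_mem_nhds (y.2.1.trans_lt hc.1) (hc.2.trans_le x.2.2))).deriv
  refine ⟨⟨c, hcm⟩, ?_⟩
  have h2 : (x : ℝ) - y ≠ 0 := (sub_pos.2 hxy).ne'
  rw [← h1, hd, div_mul_cancel₀ _ h2]
  simp only [f, realExt_apply]

theorem dist_map_le (S : Theta a b α β ρ m) (i : Fin m) (x y : Icc a b) :
    dist (S.map i x) (S.map i y) ≤ ρ * dist x y := by
  obtain ⟨c, hc⟩ := S.exists_map_sub_eq i x y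
  rw [Subtype.dist_eq, Subtype.dist_eq, Real.dist_eq, Real.dist_eq, hc, abs_mul]
  exact mul_le_mul_of_nonneg_right (S.abs_mapDeriv_le i c) (abs_nonneg _)

theorem le_dist_map (S : Theta a b α β ρ m) (i : Fin m) (x y : Icc a b) :
    β * dist x y ≤ dist (S.map i x) (S.map i y) := by
  obtain ⟨c, hc⟩ := S.exists_map_sub_eq i x y
  rw [Subtype.dist_eq, Subtype.dist_eq, Real.dist_eq, Real.dist_eq, hc, abs_mul]
  exact mul_le_mul_of_nonneg_right (S.le_abs_mapDeriv i c) (abs_nonneg _)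

theorem comp_append (S : Theta a b α β ρ m) (u v : List (Fin m)) (x : Icc a b) :
    S.comp (u ++ v) x = S.comp u (S.comp v x) := by
  induction u with
  | nil => rfl
  | cons i u ih => simp only [List.cons_append, comp, Function.comp_apply, ih]

theorem comp_singleton (S : Theta a b α β ρ m) (i : Fin m) (x : Icc a b) :
    S.comp [i] x = S.map i x := rfl

theorem comp_cons (S : Theta a b α β ρ m) (i : Fin m) (w : List (Fin m)) (x : Icc a b) :
    S.comp (i :: w) x = S.map i (S.comp w x) := rfl

theorem comp_injective (S : Theta a b α β ρ m) (w : List (Fin m)) :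
    Function.Injective (S.comp w) := by
  induction w with
  | nil => exact Function.injective_id
  | cons i w ih => exact (S.map_injective i).comp ih

theorem dist_le_length (x y : Icc a b) : dist x y ≤ b - a := by
  rw [Subtype.dist_eq, Real.dist_eq, abs_le]
  have := x.2.1; have := x.2.2; have := y.2.1; have := y.2.2
  constructor <;> linarith

theorem IsAttractor.comp_mem {S : Theta a b α β ρ m} {L : Set (Icc a b)} (hL : S.IsAttractor L)
    (w : List (Fin m)) {x : Icc a b} (hx : x ∈ L) : S.comp w x ∈ L := by
  induction w with
  | nil => exact hx
  | cons i w ih =>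
    rw [hL.2.2]
    exact mem_iUnion.2 ⟨i, _, ih, rfl⟩

section Dynamics

variable [hA : Admissible a b α β ρ]

theorem dist_comp_le (S : Theta a b α β ρ m) (w : List (Fin m)) (x y : Icc a b) :
    dist (S.comp w x) (S.comp w y) ≤ ρ ^ w.length * dist x y := by
  induction w with
  | nil => simp [comp]
  | cons i w ih =>
    rw [comp_cons, comp_cons, List.length_cons, pow_succ', mul_assoc]
    exact (S.dist_map_le i _ _).trans (mul_le_mul_of_nonneg_left ih hA.rho_pos.le)

theorem le_dist_comp (S : Theta a b α β ρ m) (w : List (Fin m)) (x y : Icc a b) :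
    β ^ w.length * dist x y ≤ dist (S.comp w x) (S.comp w y) := by
  induction w with
  | nil => simp [comp]
  | cons i w ih =>
    rw [comp_cons, comp_cons, List.length_cons, pow_succ', mul_assoc]
    exact (mul_le_mul_of_nonneg_left ih hA.beta_pos.le).trans (S.le_dist_map i _ _)

theorem continuous_comp (S : Theta a b α β ρ m) (w : List (Fin m)) : Continuous (S.comp w) :=
  LipschitzWith.continuous (K := (ρ ^ w.length).toNNReal) <| LipschitzWith.of_dist_le_mul
    fun x y => by
      rw [Real.coe_toNNReal _ (pow_nonneg hA.rho_pos.le _)]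
      exact S.dist_comp_le w x y

theorem exists_fixed (S : Theta a b α β ρ m) {w : List (Fin m)} (hw : w ≠ []) :
    ∃ x, S.comp w x = x := by
  have hne : Nonempty (Icc a b) := ⟨⟨a, left_mem_Icc.2 hA.lt.le⟩⟩
  have h0 : 0 ≤ ρ ^ w.length := pow_nonneg hA.rho_pos.le _
  have h1 : ρ ^ w.length < 1 :=
    pow_lt_one₀ hA.rho_pos.le hA.rho_lt_one (by simpa using hw)
  have hc : ContractingWith (ρ ^ w.length).toNNReal (S.comp w) := by
    refine ⟨by simpa using h1, LipschitzWith.of_dist_le_mul fun x y => ?_⟩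
    rw [Real.coe_toNNReal _ h0]
    exact S.dist_comp_le w x y
  exact ⟨_, hc.fixedPoint_isFixedPt⟩

open Classical in
/-- The fixed point of `S_w` (meaningful for `w ≠ []`). -/
noncomputable def fixPt (S : Theta a b α β ρ m) (w : List (Fin m)) : Icc a b :=
  if h : ∃ x, S.comp w x = x then h.choose else ⟨a, left_mem_Icc.2 hA.lt.le⟩

theorem comp_fixPt (S : Theta a b α β ρ m) {w : List (Fin m)} (hw : w ≠ []) :
    S.comp w (S.fixPt w) = S.fixPt w := by
  have h := S.exists_fixed hw
  unfold fixPt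
  rw [dif_pos h]
  exact h.choose_spec

theorem eq_of_fixed (S : Theta a b α β ρ m) {w : List (Fin m)} (hw : w ≠ []) {x y : Icc a b}
    (hx : S.comp w x = x) (hy : S.comp w y = y) : x = y := by
  have h1 : ρ ^ w.length < 1 :=
    pow_lt_one₀ hA.rho_pos.le hA.rho_lt_one (by simpa using hw)
  have h2 := S.dist_comp_le w x y
  rw [hx, hy] at h2
  have h3 : 0 ≤ dist x y := dist_nonneg
  exact dist_le_zero.1 (by nlinarith)

theorem eq_fixPt (S : Theta a b α β ρ m) {w : List (Fin m)} (hw : w ≠ []) {x : Icc a b}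
    (hx : S.comp w x = x) : x = S.fixPt w := S.eq_of_fixed hw hx (S.comp_fixPt hw)

theorem dist_comp_comp_le (T G : Theta a b α β ρ m) (w : List (Fin m)) (x : Icc a b) :
    dist (T.comp w x) (G.comp w x) ≤ dist T G / (1 - ρ) := by
  have hρ : 0 < 1 - ρ := sub_pos.2 hA.rho_lt_one
  induction w with
  | nil => simpa [comp] using div_nonneg dist_nonneg hρ.le
  | cons i w ih =>
    rw [comp_cons, comp_cons]
    have h1 : dist (T.map i (T.comp w x)) (G.map i (T.comp w x)) ≤ dist T G :=
      T.abs_map_sub_le_dist G i _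
    have h2 := (G.dist_map_le i (T.comp w x) (G.comp w x)).trans
      (mul_le_mul_of_nonneg_left ih hA.rho_pos.le)
    refine (dist_triangle _ (G.map i (T.comp w x)) _).trans ((add_le_add h1 h2).trans (le_of_eq ?_))
    field_simp
    ring

theorem tendsto_comp {ι : Type*} {l : Filter ι} {f : ι → Theta a b α β ρ m}
    {S : Theta a b α β ρ m} (hf : Tendsto f l (𝓝 S)) {g : ι → Icc a b} {x : Icc a b}
    (hg : Tendsto g l (𝓝 x)) (w : List (Fin m)) :
    Tendsto (fun t => (f t).comp w (g t)) l (𝓝 (S.comp w x)) := by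
  have h1 := ((S.continuous_comp w).tendsto x).comp hg
  refine tendsto_iff_dist_tendsto_zero.2 ?_
  have h2 := (tendsto_iff_dist_tendsto_zero.1 hf).div_const (1 - ρ)
  have h3 := h2.add (tendsto_iff_dist_tendsto_zero.1 h1)
  rw [zero_div, zero_add] at h3
  refine squeeze_zero (fun _ => dist_nonneg) (fun t => ?_) h3
  exact (dist_triangle _ (S.comp w (g t)) _).trans
    (add_le_add_left ((f t).dist_comp_comp_le S w (g t)) _)

theorem continuous_fixPt {w : List (Fin m)} (hw : w ≠ []) :
    Continuous fun S : Theta a b α β ρ m => S.fixPt w := by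
  have hρ : 0 < 1 - ρ ^ w.length :=
    sub_pos.2 (pow_lt_one₀ hA.rho_pos.le hA.rho_lt_one (by simpa using hw))
  refine continuous_iff_continuousAt.2 fun S => tendsto_iff_dist_tendsto_zero.2 ?_
  have h2 := ((tendsto_iff_dist_tendsto_zero.1 (continuous_id.tendsto S)).div_const
    (1 - ρ)).div_const (1 - ρ ^ w.length)
  rw [zero_div, zero_div] at h2
  refine squeeze_zero (fun _ => dist_nonneg) (fun T => ?_) h2
  rw [le_div_iff₀ hρ]
  have h3 := T.dist_comp_comp_le S w (S.fixPt w)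
  have h4 := T.dist_comp_le w (T.fixPt w) (S.fixPt w)
  have h5 := dist_triangle (T.comp w (T.fixPt w)) (T.comp w (S.fixPt w)) (S.comp w (S.fixPt w))
  rw [T.comp_fixPt hw, S.comp_fixPt hw] at h5
  rw [T.comp_fixPt hw] at h4
  rw [S.comp_fixPt hw] at h3
  simp only [id] at *
  linarith

theorem continuous_comp_fixPt (v : List (Fin m)) {w : List (Fin m)} (hw : w ≠ []) :
    Continuous fun S : Theta a b α β ρ m => S.comp v (S.fixPt w) :=
  continuous_iff_continuousAt.2 fun S =>
    tendsto_comp (continuous_id.tendsto S) ((continuous_fixPt hw).tendsto S) v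

theorem IsAttractor.fixPt_mem {S : Theta a b α β ρ m} {L : Set (Icc a b)} (hL : S.IsAttractor L)
    {w : List (Fin m)} (hw : w ≠ []) : S.fixPt w ∈ L := by
  obtain ⟨y, hy, hyd⟩ := hL.2.1.exists_infDist_eq_dist hL.1 (S.fixPt w)
  have h1 := Metric.infDist_le_dist_of_mem (x := S.fixPt w) (hL.comp_mem w hy)
  have h2 := S.dist_comp_le w (S.fixPt w) y
  rw [S.comp_fixPt hw] at h2
  have h3 : ρ ^ w.length < 1 :=
    pow_lt_one₀ hA.rho_pos.le hA.rho_lt_one (by simpa using hw)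
  have h4 : 0 ≤ dist (S.fixPt w) y := dist_nonneg
  have h5 : dist (S.fixPt w) y ≤ 0 := by
    rw [hyd] at h1
    nlinarith
  rw [dist_le_zero.1 h5]
  exact hy

theorem isAttractor (hm : 1 ≤ m) (S : Theta a b α β ρ m) : S.IsAttractor S.attractor :=
  S.isAttractor_attractor hA.lt.le hm

end Dynamics

end Theta

/-! ### Construction of perturbations -/

namespace Theta

variable {a b α β ρ : ℝ} {m : ℕ}

/-- `T` arises from `S` by adding `t • h` to the `j`-th map. -/
def IsPerturbation (S : Theta a b α β ρ m) (j : Fin m) (h : ℝ → ℝ) (t : ℝ)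
    (T : Theta a b α β ρ m) : Prop :=
  (∀ x, (T.map j x : ℝ) = S.map j x + t * h x) ∧ ∀ i, i ≠ j → T.map i = S.map i

theorem isPerturbation_zero (S : Theta a b α β ρ m) (j : Fin m) (h : ℝ → ℝ) :
    S.IsPerturbation j h 0 S := ⟨fun x => by simp, fun _ _ => rfl⟩

/-- All derivatives and values of the maps keep the distance `η` from the bounds that they have to
respect, so that small perturbations stay in `Theta`. -/
def Margin (S : Theta a b α β ρ m) (η : ℝ) : Prop :=
  ∀ i x, β + η ≤ |S.mapDeriv i x| ∧ |S.mapDeriv i x| ≤ ρ - η ∧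
    a + η ≤ S.map i x ∧ S.map i x ≤ b - η

theorem Margin.of_dist_le {S T : Theta a b α β ρ m} {η : ℝ} (hS : S.Margin η)
    (h : dist T S ≤ η / 2) : T.Margin (η / 2) := by
  intro i x
  obtain ⟨h1, h2, h3, h4⟩ := hS i x
  have h5 := abs_le.1 ((T.abs_map_sub_le_dist S i x).trans h)
  have h6 := abs_le.1 ((abs_abs_sub_abs_le _ _).trans ((T.abs_mapDeriv_sub_le_dist S i x).trans h))
  refine ⟨?_, ?_, ?_, ?_⟩ <;> linarith [h5.1, h5.2, h6.1, h6.2]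

theorem IsPerturbation.dist_le {S T G : Theta a b α β ρ m} {j : Fin m} {h : ℝ → ℝ} {s t : ℝ}
    (hT : S.IsPerturbation j h s T) (hG : S.IsPerturbation j h t G) :
    dist T G ≤ |s - t| * holderNorm α fun x : Icc a b => h x := by
  have h0 := mul_nonneg (abs_nonneg (s - t)) (holderNorm_nonneg (α := α) fun x : Icc a b => h x)
  refine dist_le_of_holderNorm h0 fun i => ?_
  by_cases hi : i = j
  · subst hi
    rw [← holderNorm_const_mul]
    refine le_of_eq (congrArg _ (funext fun x => ?_))
    simp only [diff, hT.1, hG.1]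
    ring
  · have h1 : T.diff G i = fun x : Icc a b => 0 * h x := by
      funext x
      simp [diff, hT.2 i hi, hG.2 i hi]
    rw [h1, holderNorm_const_mul, abs_zero, zero_mul]
    exact h0

theorem IsPerturbation.mapDeriv_eq [hA : Admissible a b α β ρ] {S T : Theta a b α β ρ m}
    {j : Fin m} {h : ℝ → ℝ} {t : ℝ} (hT : S.IsPerturbation j h t T) (hh : Differentiable ℝ h)
    (x : Icc a b) :
    T.mapDeriv j x = S.mapDeriv j x + t * deriv h x := by
  refine derivX_eq hA.lt ?_
  have h1 := (S.hasDerivWithinAt_map j x).add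
    (((hh x).hasDerivAt.const_mul t).hasDerivWithinAt (s := Icc a b))
  have h2 : ∀ y : Icc a b, realExt (fun y => (T.map j y : ℝ)) y =
      realExt (fun y => (S.map j y : ℝ)) y + t * h y := fun y => by
    rw [realExt_apply, realExt_apply, hT.1]
  exact h1.congr (fun y hy => h2 ⟨y, hy⟩) (h2 x)

theorem IsPerturbation.mapDeriv_eq_of_ne {S T : Theta a b α β ρ m} {j : Fin m} {h : ℝ → ℝ}
    {t : ℝ} (hT : S.IsPerturbation j h t T) {i : Fin m} (hi : i ≠ j) (x : Icc a b) :
    T.mapDeriv i x = S.mapDeriv i x := by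
  unfold mapDeriv
  rw [hT.2 i hi]

/-- A Lipschitz estimate on `[a, b]` gives a Hölder estimate with any exponent `α ≤ 1`. -/
theorem abs_sub_le_rpow (hA : Admissible a b α β ρ) (x y : Icc a b) :
    |(x : ℝ) - y| ≤ (b - a) ^ (1 - α) * |(x : ℝ) - y| ^ α := by
  have h0 : 0 ≤ |(x : ℝ) - y| := abs_nonneg _
  have h1 : |(x : ℝ) - y| ≤ b - a := dist_le_length x y
  rcases h0.eq_or_lt with h | h
  · rw [← h]
    exact mul_nonneg (Real.rpow_nonneg (sub_nonneg.2 hA.lt.le) _) (Real.rpow_nonneg le_rfl _)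
  · calc |(x : ℝ) - y| = |(x : ℝ) - y| ^ (1 - α) * |(x : ℝ) - y| ^ α := by
          rw [← Real.rpow_add h, sub_add_cancel, Real.rpow_one]
      _ ≤ _ := mul_le_mul_of_nonneg_right
          (Real.rpow_le_rpow h0 h1 (sub_nonneg.2 hA.alpha_le_one)) (Real.rpow_nonneg h0 _)

section Construction

variable [hA : Admissible a b α β ρ]

/-- Maps of `[a, b]` into itself with a Hölder continuous derivative that obeys the bounds form an
element of `Theta`: integrating the derivative, prolonged by its end point values, extends them
to conformal maps of `V = ℝ`. -/
theorem exists_of_hasDerivWithinAt (F : Fin m → Icc a b → Icc a b) (F' : Fin m → Icc a b → ℝ)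
    (hF : ∀ i x, HasDerivWithinAt (realExt fun y => (F i y : ℝ)) (F' i x) (Icc a b) x)
    (hH : ∀ i, ∃ C : ℝ, ∀ x y, |F' i x - F' i y| ≤ C * |(x : ℝ) - y| ^ α)
    (hb : ∀ i x, β ≤ |F' i x| ∧ |F' i x| ≤ ρ) :
    ∃ T : Theta a b α β ρ m, T.map = F := by
  have hab := hA.lt
  have hα := hA.alpha_pos
  refine ⟨⟨F, ⟨univ, isOpen_univ, ordConnected_univ, subset_univ _, fun i => ?_⟩, fun i x => ?_⟩,
    rfl⟩
  swap
  · rw [derivX_eq hab (hF i x)]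
    exact hb i x
  obtain ⟨C, hC⟩ := hH i
  have hC0 : 0 ≤ C := by
    have h1 := (abs_nonneg _).trans (hC ⟨a, left_mem_Icc.2 hab.le⟩ ⟨b, right_mem_Icc.2 hab.le⟩)
    have h2 : 0 < |a - b| ^ α := Real.rpow_pos_of_pos (abs_pos.2 (sub_ne_zero.2 hab.ne)) _
    exact nonneg_of_mul_nonneg_left h1 h2
  have hF'c : Continuous (F' i) := by
    refine continuous_iff_continuousAt.2 fun x => tendsto_iff_dist_tendsto_zero.2 ?_
    have h1 : Continuous fun y : Icc a b => C * |(y : ℝ) - x| ^ α := by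
      refine continuous_const.mul (Continuous.rpow_const ?_ fun _ => Or.inr hα.le)
      fun_prop
    have h2 := h1.tendsto x
    simp only [sub_self, abs_zero, Real.zero_rpow hα.ne', mul_zero] at h2
    exact squeeze_zero (fun _ => dist_nonneg) (fun y => hC y x) h2
  set φ : ℝ → ℝ := fun s => F' i (projIcc a b hab.le s)
  have hφ : Continuous φ := hF'c.comp continuous_projIcc
  set T : ℝ → ℝ := fun x => F i ⟨a, left_mem_Icc.2 hab.le⟩ + ∫ s in a..x, φ s
  have hT : ∀ x, HasDerivAt T (φ x) x := fun x =>
    (hφ.integral_hasStrictDerivAt a x).hasDerivAt.const_add _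
  have hTd : deriv T = φ := funext fun x => (hT x).deriv
  refine ⟨T, fun x => ?_, ⟨?_, ⟨C, fun x _ y _ => ?_⟩, fun x _ => ?_⟩, ?_, mapsTo_univ _ _, ρ,
    hA.rho_lt_one, fun x _ => ?_⟩
  · have h1 : ∀ z ∈ Icc a b, HasDerivWithinAt (fun s => T s - realExt (fun y => (F i y : ℝ)) s) 0
        (Icc a b) z := fun z hz => by
      have h2 := (hT z).hasDerivWithinAt.sub (hF i ⟨z, hz⟩)
      simp only [φ, projIcc_of_mem hab.le hz, sub_self] at h2
      exact h2
    have h2 := (convex_Icc a b).norm_image_sub_le_of_norm_hasDerivWithin_le (C := 0) h1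
      (fun z _ => by simp) (left_mem_Icc.2 hab.le) x.2
    have h3 := realExt_apply (fun y => (F i y : ℝ)) ⟨a, left_mem_Icc.2 hab.le⟩
    rw [zero_mul, norm_le_zero_iff] at h2
    dsimp only at h2 h3
    have h4 := realExt_apply (fun y => (F i y : ℝ)) x
    have h5 : T a = F i ⟨a, left_mem_Icc.2 hab.le⟩ := by simp [T]
    rw [h3, h4, h5] at h2
    linarith
  · refine contDiffOn_univ.2 (contDiff_one_iff_deriv.2 ⟨fun x => (hT x).differentiableAt, ?_⟩)
    rw [hTd]
    exact hφ
  · rw [hTd]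
    refine (hC _ _).trans (mul_le_mul_of_nonneg_left ?_ hC0)
    refine Real.rpow_le_rpow (abs_nonneg _) ?_ hα.le
    exact abs_projIcc_sub_projIcc hab.le
  · rw [hTd]
    exact abs_pos.1 (hA.beta_pos.trans_le (hb i _).1)
  · intro x _ y _ hxy
    by_contra hne
    wlog hlt : x < y generalizing x y
    · exact this trivial trivial hxy.symm (Ne.symm hne) ((not_lt.1 hlt).lt_of_ne (Ne.symm hne))
    obtain ⟨c, -, hc⟩ := exists_deriv_eq_zero hlt
      (fun z _ => (hT z).continuousAt.continuousWithinAt) hxy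
    rw [hTd] at hc
    exact abs_pos.1 (hA.beta_pos.trans_le (hb i _).1) hc
  · rw [hTd]
    exact (hb i _).2

theorem exists_isPerturbation (S : Theta a b α β ρ m) {η : ℝ} (hη : 0 < η) (hS : S.Margin η)
    (j : Fin m) {h : ℝ → ℝ} (hh : ContDiff ℝ 2 h) :
    ∃ t₀ > 0, ∀ t : ℝ, |t| ≤ t₀ → ∃ T, S.IsPerturbation j h t T := by
  have hab := hA.lt
  have hd : Differentiable ℝ h := hh.differentiable two_ne_zero
  have hh' : ContDiff ℝ 1 (deriv h) := by
    have h2 : ContDiff ℝ (1 + 1) h := by norm_num; exact hh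
    exact (contDiff_succ_iff_deriv.1 h2).2.2
  obtain ⟨M₀, hM₀⟩ := (isCompact_Icc (a := a) (b := b)).exists_bound_of_continuousOn
    hh.continuous.continuousOn
  obtain ⟨M₁, hM₁⟩ := (isCompact_Icc (a := a) (b := b)).exists_bound_of_continuousOn
    hh'.continuous.continuousOn
  obtain ⟨M₂, hM₂⟩ := (isCompact_Icc (a := a) (b := b)).exists_bound_of_continuousOn
    (hh'.continuous_deriv le_rfl).continuousOn
  set M := max (max M₀ M₁) 0 + 1
  have hM : 0 < M := by positivity
  have hMh : ∀ x ∈ Icc a b, |h x| ≤ M := fun x hx =>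
    (hM₀ x hx).trans (by linarith [le_max_left (max M₀ M₁) 0, le_max_left M₀ M₁])
  have hMh' : ∀ x ∈ Icc a b, |deriv h x| ≤ M := fun x hx =>
    (hM₁ x hx).trans (by linarith [le_max_left (max M₀ M₁) 0, le_max_right M₀ M₁])
  refine ⟨η / M, div_pos hη hM, fun t ht => ?_⟩
  rw [le_div_iff₀ hM] at ht
  have hth : ∀ x : Icc a b, |t * h x| ≤ η := fun x => by
    rw [abs_mul]
    exact (mul_le_mul_of_nonneg_left (hMh x x.2) (abs_nonneg t)).trans ht
  have hth' : ∀ x : Icc a b, |t * deriv h x| ≤ η := fun x => by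
    rw [abs_mul]
    exact (mul_le_mul_of_nonneg_left (hMh' x x.2) (abs_nonneg t)).trans ht
  set F : Fin m → Icc a b → Icc a b := fun i x =>
    projIcc a b hab.le (S.map i x + if i = j then t * h x else 0)
  set F' : Fin m → Icc a b → ℝ := fun i x =>
    S.mapDeriv i x + if i = j then t * deriv h x else 0
  have hFv : ∀ i x, (F i x : ℝ) = S.map i x + if i = j then t * h x else 0 := fun i x => by
    have h1 : (S.map i x : ℝ) + (if i = j then t * h x else 0) ∈ Icc a b := by
      split_ifs with hi
      · obtain ⟨-, -, h3, h4⟩ := hS i x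
        have := abs_le.1 (hth x)
        constructor <;> linarith
      · simp
    simp only [F]
    rw [projIcc_of_mem hab.le h1]
  have hder : ∀ i x, HasDerivWithinAt (realExt fun y => (F i y : ℝ)) (F' i x) (Icc a b) x := by
    intro i x
    have h1 : HasDerivWithinAt (fun s => realExt (fun y => (S.map i y : ℝ)) s +
        if i = j then t * h s else 0) (F' i x) (Icc a b) x := by
      refine (S.hasDerivWithinAt_map i x).add ?_
      split_ifs with hi
      · exact ((hd x).hasDerivAt.const_mul t).hasDerivWithinAt
      · exact hasDerivWithinAt_const _ _ _
    have h2 : ∀ y : Icc a b, realExt (fun y => (F i y : ℝ)) y =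
        realExt (fun y => (S.map i y : ℝ)) y + if i = j then t * h y else 0 := fun y => by
      rw [realExt_apply, realExt_apply, hFv]
    exact h1.congr (fun y hy => h2 ⟨y, hy⟩) (h2 x)
  have hH : ∀ i, ∃ C : ℝ, ∀ x y, |F' i x - F' i y| ≤ C * |(x : ℝ) - y| ^ α := by
    intro i
    obtain ⟨C, hC⟩ := S.holder_map i
    refine ⟨C + |t| * (M₂ * (b - a) ^ (1 - α)), fun x y => ?_⟩
    have hM₂0 : 0 ≤ M₂ := (norm_nonneg _).trans (hM₂ x x.2)
    have h1 : |(if i = j then t * deriv h x else 0) - (if i = j then t * deriv h y else 0)| ≤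
        |t| * (M₂ * (b - a) ^ (1 - α)) * |(x : ℝ) - y| ^ α := by
      have h0 : |t| * (M₂ * |(x : ℝ) - y|) ≤
          |t| * (M₂ * (b - a) ^ (1 - α)) * |(x : ℝ) - y| ^ α := by
        rw [mul_assoc, mul_assoc]
        exact mul_le_mul_of_nonneg_left
          (mul_le_mul_of_nonneg_left (abs_sub_le_rpow hA x y) hM₂0) (abs_nonneg t)
      refine le_trans ?_ h0
      split_ifs with hi
      · rw [← mul_sub, abs_mul]
        refine mul_le_mul_of_nonneg_left ?_ (abs_nonneg t)
        exact (convex_Icc a b).norm_image_sub_le_of_norm_deriv_le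
          (fun z _ => (hh'.differentiable one_ne_zero) z) hM₂ y.2 x.2
      · simp only [sub_self, abs_zero]
        positivity
    have h2 : F' i x - F' i y = (S.mapDeriv i x - S.mapDeriv i y) +
        ((if i = j then t * deriv h x else 0) - (if i = j then t * deriv h y else 0)) := by
      simp only [F']
      ring
    rw [h2, add_mul]
    exact (abs_add_le _ _).trans (add_le_add (hC x y) h1)
  have hb : ∀ i x, β ≤ |F' i x| ∧ |F' i x| ≤ ρ := by
    intro i x
    simp only [F']
    split_ifs with hi
    · obtain ⟨h1, h2, -, -⟩ := hS i x
      have h3 := hth' x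
      have h4 := abs_add_le (S.mapDeriv i x) (t * deriv h x)
      have h5 := abs_sub_abs_le_abs_add (S.mapDeriv i x) (t * deriv h x)
      constructor <;> linarith
    · rw [add_zero]
      exact S.bounds i x
  obtain ⟨T, hT⟩ := exists_of_hasDerivWithinAt F F' hder hH hb
  refine ⟨T, fun x => ?_, fun i hi => funext fun x => Subtype.ext ?_⟩
  · rw [hT, hFv, if_pos rfl]
  · rw [hT, hFv, if_neg hi, add_zero]

theorem exists_isPerturbation_mem {O : Set (Theta a b α β ρ m)} (hO : IsOpen O)
    {S : Theta a b α β ρ m} (hSO : S ∈ O) {η : ℝ} (hη : 0 < η) (hS : S.Margin η)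
    (j : Fin m) {h : ℝ → ℝ} (hh : ContDiff ℝ 2 h) :
    ∃ t₀ > 0, ∀ t : ℝ, |t| ≤ t₀ → ∃ T ∈ O, S.IsPerturbation j h t T := by
  obtain ⟨t₁, ht₁, hp⟩ := S.exists_isPerturbation hη hS j hh
  obtain ⟨δ, hδ, hδO⟩ := Metric.isOpen_iff.1 hO S hSO
  obtain ⟨c, hc, hcδ⟩ := exists_pos_mul_lt hδ (holderNorm α fun x : Icc a b => h x)
  refine ⟨min t₁ c, lt_min ht₁ hc, fun t ht => ?_⟩
  obtain ⟨T, hT⟩ := hp t (ht.trans (min_le_left _ _))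
  refine ⟨T, hδO ((hT.dist_le (S.isPerturbation_zero j h)).trans_lt (lt_of_le_of_lt ?_ hcδ)), hT⟩
  rw [sub_zero, mul_comm]
  exact mul_le_mul_of_nonneg_left (ht.trans (min_le_right _ _)) (holderNorm_nonneg _)

/-- The derivative of each map has a constant sign `σ`, by Darboux's theorem. -/
theorem exists_sign (S : Theta a b α β ρ m) (i : Fin m) :
    ∃ σ : ℝ, |σ| = 1 ∧ ∀ x, S.mapDeriv i x = σ * |S.mapDeriv i x| := by
  have hne : ∀ x ∈ Icc a b, (fun s => S.mapDeriv i (projIcc a b hA.lt.le s)) x ≠ 0 := fun x _ =>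
    abs_pos.1 (hA.beta_pos.trans_le (S.le_abs_mapDeriv i _))
  rcases hasDerivWithinAt_forall_lt_or_forall_gt_of_forall_ne (convex_Icc a b)
    (fun x hx => by
      have := S.hasDerivWithinAt_map i ⟨x, hx⟩
      simpa only [projIcc_of_mem hA.lt.le hx] using this) hne with h | h
  · refine ⟨-1, by simp, fun x => ?_⟩
    have := h x x.2
    simp only [projIcc_val] at this
    rw [abs_of_neg this]
    ring
  · refine ⟨1, by simp, fun x => ?_⟩
    have := h x x.2
    simp only [projIcc_val] at this
    rw [abs_of_pos this, one_mul]

/-- Elements with a positive margin are dense: move each map slightly towards an affine map with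
the same orientation, centred at the mid-point of the interval. -/
theorem exists_margin (S : Theta a b α β ρ m) {ε : ℝ} (hε : 0 < ε) :
    ∃ T : Theta a b α β ρ m, dist T S < ε ∧ ∃ η > 0, T.Margin η := by
  have hab := hA.lt
  have hβρ := hA.beta_lt_rho
  have hβ := hA.beta_pos
  have hρ := hA.rho_lt_one
  have hρ0 := hA.rho_pos
  choose σ hσ hσS using S.exists_sign
  set κ := (β + ρ) / 2 with hκ
  have hκ0 : 0 < κ := by positivity
  set c := (a + b) / 2 with hc
  set L : Fin m → ℝ → ℝ := fun i x => c + σ i * κ * (x - c) with hL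
  set K : ℝ := ∑ i, holderNorm α fun x : Icc a b => L i x - S.map i x
  have hK0 : ∀ i, 0 ≤ holderNorm α fun x : Icc a b => L i x - S.map i x := fun i =>
    holderNorm_nonneg _
  have hK : ∀ i, holderNorm α (fun x : Icc a b => L i x - S.map i x) ≤ K := fun i =>
    Finset.single_le_sum (f := fun i => holderNorm α fun x : Icc a b => L i x - S.map i x)
      (fun i _ => hK0 i) (Finset.mem_univ i)
  have hKn : 0 ≤ K := Finset.sum_nonneg fun i _ => hK0 i
  obtain ⟨t, ht0, ht1, htε⟩ : ∃ t : ℝ, 0 < t ∧ t < 1 ∧ t * K < ε := by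
    refine ⟨min (1 / 2) (ε / (2 * (K + 1))), by positivity,
      (min_le_left _ _).trans_lt (by norm_num), ?_⟩
    calc min (1 / 2) (ε / (2 * (K + 1))) * K ≤ ε / (2 * (K + 1)) * K :=
          mul_le_mul_of_nonneg_right (min_le_right _ _) hKn
      _ < ε := by
          rw [div_mul_eq_mul_div, div_lt_iff₀ (by positivity)]
          nlinarith
  have hLx : ∀ i (x : Icc a b), a + (1 - κ) * (b - a) / 2 ≤ L i x ∧
      L i x ≤ b - (1 - κ) * (b - a) / 2 := fun i x => by
    have h1 : |σ i * κ * (x - c)| ≤ κ * ((b - a) / 2) := by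
      rw [abs_mul, abs_mul, hσ, one_mul, abs_of_pos hκ0]
      refine mul_le_mul_of_nonneg_left ?_ hκ0.le
      have := x.2.1; have := x.2.2
      rw [abs_le]
      constructor <;> linarith
    have h2 := abs_le.1 h1
    simp only [hL]
    constructor <;> linarith [h2.1, h2.2]
  set F : Fin m → Icc a b → Icc a b := fun i x =>
    projIcc a b hab.le ((1 - t) * S.map i x + t * L i x)
  set F' : Fin m → Icc a b → ℝ := fun i x => (1 - t) * S.mapDeriv i x + t * (σ i * κ)
  have hκ1 : 0 < (1 - κ) * (b - a) / 2 := by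
    have : 0 < 1 - κ := by linarith
    have : 0 < b - a := by linarith
    positivity
  have hin : ∀ i (x : Icc a b), a + t * ((1 - κ) * (b - a) / 2) ≤
      (1 - t) * S.map i x + t * L i x ∧
      (1 - t) * S.map i x + t * L i x ≤ b - t * ((1 - κ) * (b - a) / 2) := fun i x => by
    obtain ⟨h1, h2⟩ := hLx i x
    have h3 := (S.map i x).2
    constructor <;> nlinarith [h3.1, h3.2]
  have hFv : ∀ i x, (F i x : ℝ) = (1 - t) * S.map i x + t * L i x := fun i x => by
    have h1 : (1 - t) * (S.map i x : ℝ) + t * L i x ∈ Icc a b := by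
      have := hin i x
      have := mul_pos ht0 hκ1
      constructor <;> linarith
    simp only [F]
    rw [projIcc_of_mem hab.le h1]
  have hF'a : ∀ i x, |F' i x| = (1 - t) * |S.mapDeriv i x| + t * κ := fun i x => by
    have h1 : F' i x = σ i * ((1 - t) * |S.mapDeriv i x| + t * κ) := by
      simp only [F']
      conv_lhs => rw [hσS i x]
      ring
    have h2 : 0 ≤ (1 - t) * |S.mapDeriv i x| + t * κ := by
      have : 0 < 1 - t := by linarith
      positivity
    rw [h1, abs_mul, hσ, one_mul, abs_of_nonneg h2]
  have hF'b : ∀ i x, β + t * ((ρ - β) / 2) ≤ |F' i x| ∧ |F' i x| ≤ ρ - t * ((ρ - β) / 2) :=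
    fun i x => by
      rw [hF'a]
      have h1 := S.le_abs_mapDeriv i x
      have h2 := S.abs_mapDeriv_le i x
      constructor <;> nlinarith
  have hpos : 0 < t * ((ρ - β) / 2) := mul_pos ht0 (by linarith)
  have hder : ∀ i x, HasDerivWithinAt (realExt fun y => (F i y : ℝ)) (F' i x) (Icc a b) x := by
    intro i x
    have h1 : HasDerivWithinAt (fun s => (1 - t) * realExt (fun y => (S.map i y : ℝ)) s +
        t * L i s) (F' i x) (Icc a b) x := by
      refine ((S.hasDerivWithinAt_map i x).const_mul _).add ?_
      refine HasDerivAt.hasDerivWithinAt (HasDerivAt.const_mul _ ?_)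
      have := (((hasDerivAt_id (x : ℝ)).sub_const c).const_mul (σ i * κ)).const_add c
      simpa [hL] using this
    have h2 : ∀ y : Icc a b, realExt (fun y => (F i y : ℝ)) y =
        (1 - t) * realExt (fun y => (S.map i y : ℝ)) y + t * L i y := fun y => by
      rw [realExt_apply, realExt_apply, hFv]
    exact h1.congr (fun y hy => h2 ⟨y, hy⟩) (h2 x)
  have hH : ∀ i, ∃ C : ℝ, ∀ x y, |F' i x - F' i y| ≤ C * |(x : ℝ) - y| ^ α := by
    intro i
    obtain ⟨C, hC⟩ := S.holder_map i
    refine ⟨(1 - t) * C, fun x y => ?_⟩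
    have h1 : F' i x - F' i y = (1 - t) * (S.mapDeriv i x - S.mapDeriv i y) := by
      simp only [F']
      ring
    have h2 : 0 < 1 - t := by linarith
    rw [h1, abs_mul, abs_of_pos h2, mul_assoc]
    exact mul_le_mul_of_nonneg_left (hC x y) h2.le
  have hb : ∀ i x, β ≤ |F' i x| ∧ |F' i x| ≤ ρ := by
    intro i x
    have := hF'b i x
    constructor <;> linarith [this.1, this.2]
  obtain ⟨T, hT⟩ := exists_of_hasDerivWithinAt F F' hder hH hb
  refine ⟨T, ?_, min (t * ((ρ - β) / 2)) (t * ((1 - κ) * (b - a) / 2)),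
    lt_min hpos (mul_pos ht0 hκ1), fun i x => ?_⟩
  · refine (dist_le_of_holderNorm (by positivity) fun i => ?_).trans_lt htε
    have h1 : T.diff S i = fun x : Icc a b => t * (L i x - S.map i x) := by
      funext x
      simp only [diff, hT, hFv]
      ring
    rw [h1, holderNorm_const_mul, abs_of_pos ht0]
    exact mul_le_mul_of_nonneg_left (hK i) ht0.le
  · have h1 : T.mapDeriv i x = F' i x := by
      unfold mapDeriv
      rw [hT]
      exact derivX_eq hab (hder i x)
    rw [h1, hT, hFv]
    have h2 := min_le_left (t * ((ρ - β) / 2)) (t * ((1 - κ) * (b - a) / 2))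
    have h3 := min_le_right (t * ((ρ - β) / 2)) (t * ((1 - κ) * (b - a) / 2))
    have h4 := hF'b i x
    have h5 := hin i x
    refine ⟨?_, ?_, ?_, ?_⟩ <;> linarith [h4.1, h4.2, h5.1, h5.2]

/-- Every non-empty open set contains a non-empty open set of elements that have a positive margin
and whose maps `o` and `l` have distinct fixed points. -/
theorem exists_open_regular {o l : Fin m} (hol : o ≠ l) {O : Set (Theta a b α β ρ m)}
    (hO : IsOpen O) (hne : O.Nonempty) : ∃ O' ⊆ O, IsOpen O' ∧ O'.Nonempty ∧
      ∀ S ∈ O', S.fixPt [o] ≠ S.fixPt [l] ∧ ∃ η > 0, S.Margin η := by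
  obtain ⟨S, hS⟩ := hne
  obtain ⟨ε, hε, hεO⟩ := Metric.isOpen_iff.1 hO S hS
  obtain ⟨T, hTS, η, hη, hT⟩ := S.exists_margin hε
  have hopen : IsOpen {G : Theta a b α β ρ m | G.fixPt [o] ≠ G.fixPt [l]} :=
    isOpen_ne_fun (continuous_fixPt (by simp)) (continuous_fixPt (by simp))
  refine ⟨O ∩ Metric.ball T (η / 2) ∩ {G | G.fixPt [o] ≠ G.fixPt [l]},
    fun G hG => hG.1.1, (hO.inter Metric.isOpen_ball).inter hopen, ?_, ?_⟩
  · have hTO : T ∈ O := hεO hTS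
    by_cases hTf : T.fixPt [o] = T.fixPt [l]
    · obtain ⟨t, ht, hp⟩ := exists_isPerturbation_mem (hO.inter Metric.isOpen_ball)
        ⟨hTO, Metric.mem_ball_self (half_pos hη)⟩ hη hT o (h := fun _ => 1) contDiff_const
      obtain ⟨G, hGO, hG⟩ := hp t (abs_of_pos ht).le
      refine ⟨G, hGO, fun hGf => ?_⟩
      have h1 : G.comp [l] (T.fixPt [l]) = T.fixPt [l] := by
        rw [comp_singleton, hG.2 l hol.symm, ← comp_singleton, T.comp_fixPt (by simp)]
      rw [← G.eq_fixPt (by simp) h1, ← hTf] at hGf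
      have h2 := G.comp_fixPt (w := [o]) (by simp)
      have h3 := T.comp_fixPt (w := [o]) (by simp)
      rw [hGf, comp_singleton] at h2
      rw [comp_singleton] at h3
      have h4 := hG.1 (T.fixPt [o])
      rw [h2, h3] at h4
      linarith
    · exact ⟨T, ⟨hTO, Metric.mem_ball_self (half_pos hη)⟩, hTf⟩
  · rintro G ⟨⟨-, hG⟩, hf⟩
    exact ⟨hf, η / 2, half_pos hη, hT.of_dist_le (le_of_lt hG)⟩

end Construction

end Theta

/-! ### Exact overlaps -/

/-- Two distinct words, read from the right, either differ at some letter or one of them is a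
proper final segment of the other. -/
theorem exists_common_suffix {ι : Type*} {u v : List ι} (huv : u ≠ v) : ∃ s,
    (∃ u' v' i j, i ≠ j ∧ u = u' ++ i :: s ∧ v = v' ++ j :: s) ∨
    (∃ t, t ≠ [] ∧ u = t ++ s ∧ v = s) ∨ ∃ t, t ≠ [] ∧ v = t ++ s ∧ u = s := by
  induction u using List.reverseRecOn generalizing v with
  | nil => exact ⟨[], Or.inr (Or.inr ⟨v, huv.symm, by simp, rfl⟩)⟩
  | append_singleton u i ih =>
    rcases List.eq_nil_or_concat' v with rfl | ⟨v, j, rfl⟩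
    · exact ⟨[], Or.inr (Or.inl ⟨_, huv, by simp, rfl⟩)⟩
    · by_cases hij : i = j
      · subst hij
        obtain ⟨s, hs⟩ := ih (v := v) fun h => huv (by rw [h])
        refine ⟨s ++ [i], ?_⟩
        rcases hs with ⟨u', v', k, l, hkl, rfl, rfl⟩ | ⟨t, ht, rfl, rfl⟩ | ⟨t, ht, rfl, rfl⟩
        · exact Or.inl ⟨u', v', k, l, hkl, by simp, by simp⟩
        · exact Or.inr (Or.inl ⟨t, ht, by simp, rfl⟩)
        · exact Or.inr (Or.inr ⟨t, ht, by simp, rfl⟩)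
      · exact ⟨[], Or.inl ⟨u, v, i, j, hij, rfl, rfl⟩⟩

/-- A polynomial that vanishes on a finite set, to second order except at the point `c`. -/
theorem exists_contDiff_simple_zero (Z : Finset ℝ) (c : ℝ) : ∃ h : ℝ → ℝ, ContDiff ℝ 2 h ∧
    h c = 0 ∧ deriv h c ≠ 0 ∧ (∀ z ∈ Z, h z = 0) ∧ ∀ z ∈ Z, z ≠ c → deriv h z = 0 := by
  classical
  set g : ℝ → ℝ := fun y => ∏ z ∈ Z.erase c, (y - z) ^ 2
  have hg : ContDiff ℝ 2 g := contDiff_prod fun z _ => by fun_prop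
  have hd : ∀ y, HasDerivAt (fun y => (y - c) * g y) (1 * g y + (y - c) * deriv g y) y := fun y =>
    ((hasDerivAt_id y).sub_const c).mul (hg.differentiable two_ne_zero y).hasDerivAt
  have hgz : ∀ z ∈ Z, z ≠ c → g z = 0 ∧ deriv g z = 0 := by
    intro z hz hzc
    set k : ℝ → ℝ := fun y => ∏ z ∈ (Z.erase c).erase z, (y - z) ^ 2
    have hk : ContDiff ℝ 2 k := contDiff_prod fun z _ => by fun_prop
    have hgk : g = fun y => (y - z) ^ 2 * k y := funext fun y =>
      (Finset.mul_prod_erase _ (fun z => (y - z) ^ 2) (Finset.mem_erase.2 ⟨hzc, hz⟩)).symm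
    have h1 := (((hasDerivAt_id z).sub_const z).pow 2).mul
      (hk.differentiable two_ne_zero z).hasDerivAt
    constructor
    · rw [hgk]; simp
    · rw [hgk]
      exact (h1.congr_deriv (by simp)).deriv
  refine ⟨fun y => (y - c) * g y, by fun_prop, by simp, ?_, fun z hz => ?_, fun z hz hzc => ?_⟩
  · rw [(hd c).deriv, sub_self, zero_mul, one_mul, add_zero]
    exact Finset.prod_ne_zero_iff.2 fun z hz =>
      pow_ne_zero 2 (sub_ne_zero.2 (Finset.ne_of_mem_erase hz).symm)
  · by_cases hzc : z = c
    · simp [hzc]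
    · simp [(hgz z hz hzc).1]
  · rw [(hd z).deriv, (hgz z hz hzc).1, (hgz z hz hzc).2]
    simp

namespace Theta

variable {a b α β ρ : ℝ} {m : ℕ}

/-- The derivative of `S_w`, as given by the chain rule. -/
noncomputable def compDeriv (S : Theta a b α β ρ m) : List (Fin m) → Icc a b → ℝ
  | [], _ => 1
  | i :: w, x => S.mapDeriv i (S.comp w x) * S.compDeriv w x

theorem compDeriv_append (S : Theta a b α β ρ m) (u v : List (Fin m)) (x : Icc a b) :
    S.compDeriv (u ++ v) x = S.compDeriv u (S.comp v x) * S.compDeriv v x := by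
  induction u with
  | nil => simp [compDeriv]
  | cons i u ih => simp only [List.cons_append, compDeriv, ih, comp_append, mul_assoc]

theorem hasDerivWithinAt_comp (S : Theta a b α β ρ m) (w : List (Fin m)) (x : Icc a b) :
    HasDerivWithinAt (realExt fun y => (S.comp w y : ℝ)) (S.compDeriv w x) (Icc a b) x := by
  induction w with
  | nil =>
    have h : ∀ y : Icc a b, realExt (fun y => (S.comp [] y : ℝ)) y = id (y : ℝ) := fun y => by
      rw [realExt_apply]; rfl
    exact (hasDerivWithinAt_id _ _).congr (fun y hy => h ⟨y, hy⟩) (h x)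
  | cons i w ih =>
    have h : ∀ y : Icc a b, realExt (fun y => (S.comp (i :: w) y : ℝ)) y =
        (realExt (fun y => (S.map i y : ℝ)) ∘ realExt fun y => (S.comp w y : ℝ)) y := fun y => by
      rw [Function.comp_apply, realExt_apply, realExt_apply, realExt_apply]
      rfl
    have h1 := S.hasDerivWithinAt_map i (S.comp w x)
    rw [← realExt_apply (fun y => (S.comp w y : ℝ)) x] at h1
    refine (h1.comp (x : ℝ) ih fun y hy => ?_).congr (fun y hy => h ⟨y, hy⟩) (h x)
    rw [realExt_apply (fun y => (S.comp w y : ℝ)) ⟨y, hy⟩]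
    exact (S.comp w ⟨y, hy⟩).2

theorem compDeriv_congr {S T : Theta a b α β ρ m} {x : Icc a b} {w : List (Fin m)}
    (hc : ∀ r, r <:+ w → T.comp r x = S.comp r x)
    (hd : ∀ k r, (k :: r) <:+ w → T.mapDeriv k (S.comp r x) = S.mapDeriv k (S.comp r x)) :
    T.compDeriv w x = S.compDeriv w x := by
  induction w with
  | nil => rfl
  | cons i w ih =>
    have hw : w <:+ i :: w := List.suffix_cons i w
    rw [compDeriv, compDeriv, hc w hw, hd i w (List.suffix_refl _),
      ih (fun r hr => hc r (hr.trans hw)) fun k r hr => hd k r (hr.trans hw)]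

theorem IsPerturbation.comp_eq {S T : Theta a b α β ρ m} {i : Fin m} {h : ℝ → ℝ} {t : ℝ}
    (hT : S.IsPerturbation i h t T) {x : Icc a b} {N : ℕ}
    (hN : ∀ w : List (Fin m), w.length ≤ N → h (S.comp w x) = 0) :
    ∀ w : List (Fin m), w.length ≤ N + 1 → T.comp w x = S.comp w x := by
  intro w
  induction w with
  | nil => exact fun _ => rfl
  | cons k w ih =>
    intro hw
    rw [List.length_cons, Nat.add_le_add_iff_right] at hw
    rw [comp_cons, comp_cons, ih (by omega)]
    by_cases hk : k = i
    · subst hk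
      exact Subtype.ext (by rw [hT.1, hN w hw, mul_zero, add_zero])
    · rw [hT.2 k hk]

section Overlap

variable [hA : Admissible a b α β ρ]

theorem compDeriv_ne_zero (S : Theta a b α β ρ m) (w : List (Fin m)) (x : Icc a b) :
    S.compDeriv w x ≠ 0 := by
  induction w with
  | nil => exact one_ne_zero
  | cons i w ih =>
    exact mul_ne_zero (abs_pos.1 (hA.beta_pos.trans_le (S.le_abs_mapDeriv i _))) ih

theorem comp_replicate_fixPt (S : Theta a b α β ρ m) (o : Fin m) (k : ℕ) :
    S.comp (List.replicate k o) (S.fixPt [o]) = S.fixPt [o] := by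
  induction k with
  | zero => rfl
  | succ k ih =>
    rw [List.replicate_succ, comp_cons, ih]
    exact S.comp_fixPt (w := [o]) (by simp)

theorem map_fixPt_ne {S : Theta a b α β ρ m} {o l : Fin m} (hol : S.fixPt [o] ≠ S.fixPt [l]) :
    S.map l (S.fixPt [o]) ≠ S.fixPt [o] := fun h =>
  hol (S.eq_fixPt (w := [l]) (by simp) h)

/-- The images of a fixed point under the maps `S_w` form a set without isolated points. -/
theorem accPt_comp_fixPt {S : Theta a b α β ρ m} {o l : Fin m}
    (hol : S.fixPt [o] ≠ S.fixPt [l]) (w : List (Fin m)) :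
    AccPt (S.comp w (S.fixPt [o]) : ℝ)
      (𝓟 (range fun w => (S.comp w (S.fixPt [o]) : ℝ))) := by
  rw [accPt_iff_nhds]
  intro U hU
  obtain ⟨ε, hε, hεU⟩ := Metric.mem_nhds_iff.1 hU
  obtain ⟨k, hk⟩ := hA.exists_pow_mul_le (b - a) (half_pos hε)
  have h1 : S.comp (w ++ List.replicate k o) (S.fixPt [o]) = S.comp w (S.fixPt [o]) := by
    rw [comp_append, comp_replicate_fixPt]
  refine ⟨S.comp (w ++ List.replicate k o ++ [l]) (S.fixPt [o]), ⟨hεU ?_, ⟨_, rfl⟩⟩, fun h => ?_⟩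
  · rw [← h1, comp_append _ _ [l]]
    refine lt_of_le_of_lt ?_ (hk.trans_lt (half_lt_self hε))
    have h2 := S.dist_comp_le (w ++ List.replicate k o) (S.comp [l] (S.fixPt [o])) (S.fixPt [o])
    refine (show dist _ _ ≤ _ from h2).trans (mul_le_mul ?_ (dist_le_length _ _) dist_nonneg
      (pow_nonneg hA.rho_pos.le _))
    exact pow_le_pow_of_le_one hA.rho_pos.le hA.rho_lt_one.le (by simp)
  · rw [comp_append _ _ [l], ← h1] at h
    exact map_fixPt_ne hol (S.comp_injective _ (Subtype.ext h))

theorem compDeriv_eq_of_comp_eq {S : Theta a b α β ρ m} {o l : Fin m}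
    (hol : S.fixPt [o] ≠ S.fixPt [l]) {u v : List (Fin m)}
    (h : ∀ w, S.comp u (S.comp w (S.fixPt [o])) = S.comp v (S.comp w (S.fixPt [o])))
    (w : List (Fin m)) :
    S.compDeriv u (S.comp w (S.fixPt [o])) = S.compDeriv v (S.comp w (S.fixPt [o])) := by
  have hsub : (range fun w => (S.comp w (S.fixPt [o]) : ℝ)) ⊆ Icc a b := by
    rintro _ ⟨w, rfl⟩
    exact (S.comp w (S.fixPt [o])).2
  refine (uniqueDiffWithinAt_iff_accPt.2 (accPt_comp_fixPt hol w)).eq_deriv _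
    ((S.hasDerivWithinAt_comp u (S.comp w (S.fixPt [o]))).mono hsub) ?_
  have h1 : ∀ w, realExt (fun y => (S.comp u y : ℝ)) (S.comp w (S.fixPt [o])) =
      realExt (fun y => (S.comp v y : ℝ)) (S.comp w (S.fixPt [o])) := fun w => by
    rw [realExt_apply, realExt_apply, h]
  refine ((S.hasDerivWithinAt_comp v (S.comp w (S.fixPt [o]))).mono hsub).congr ?_ (h1 w)
  rintro _ ⟨w, rfl⟩
  exact h1 w

/-- An overlap between words that differ in a letter is destroyed by a perturbation that keeps the
orbits in question and changes the derivative at a single point of them. -/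
theorem exists_comp_ne_of_letter_ne {O : Set (Theta a b α β ρ m)} (hO : IsOpen O)
    {S : Theta a b α β ρ m} (hSO : S ∈ O) {η : ℝ} (hη : 0 < η) (hS : S.Margin η) {o l : Fin m}
    (hreg : ∀ T ∈ O, T.fixPt [o] ≠ T.fixPt [l]) {u v s : List (Fin m)} {i j : Fin m}
    (hij : i ≠ j) : ∃ T ∈ O, ∃ w, T.comp (u ++ i :: s) (T.comp w (T.fixPt [o])) ≠
      T.comp (v ++ j :: s) (T.comp w (T.fixPt [o])) := by
  by_contra! H
  set p := S.fixPt [o] with hp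
  have hinj := S.comp_injective s
  set M := u.length + v.length + 1 with hM
  -- The base point is chosen so that its image under `S_s` is not fixed by any short word.
  obtain ⟨w, hw⟩ : ∃ w, ∀ r : List (Fin m), r ≠ [] → r.length ≤ M →
      S.comp r (S.comp s (S.comp w p)) ≠ S.comp s (S.comp w p) := by
    have hinf : (range fun w => S.comp w p).Infinite := by
      have h1 := Set.Infinite.of_accPt (accPt_comp_fixPt (hreg S hSO) [])
      have h2 : (range fun w => (S.comp w p : ℝ)) = Subtype.val '' range fun w => S.comp w p := by
        rw [← range_comp]; rfl
      rw [← hp, h2] at h1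
      exact h1.of_image _
    have hfin : (S.comp s ⁻¹' (S.fixPt '' {r | r.length ≤ M})).Finite :=
      ((List.finite_length_le (Fin m) M).image _).preimage hinj.injOn
    obtain ⟨_, ⟨w, rfl⟩, hw⟩ := hinf.exists_notMem_finite hfin
    exact ⟨w, fun r hr hrM h => hw ⟨r, hrM, (S.eq_fixPt hr h).symm⟩⟩
  set x := S.comp w p with hx
  set z := S.comp s x with hz
  set N := M + s.length + w.length + 1 with hN
  classical
  set Z : Finset ℝ := ((List.finite_length_le (Fin m) N).image fun r => (S.comp r p : ℝ)).toFinset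
  have hZ : ∀ r : List (Fin m), r.length ≤ N → (S.comp r p : ℝ) ∈ Z := fun r hr => by
    simp only [Z, Set.Finite.mem_toFinset]
    exact ⟨r, hr, rfl⟩
  obtain ⟨h, hh, -, hh1, hh2, hh3⟩ := exists_contDiff_simple_zero Z z
  obtain ⟨t, ht, hpert⟩ := exists_isPerturbation_mem hO hSO hη hS i hh
  obtain ⟨T, hTO, hT⟩ := hpert t (abs_of_pos ht).le
  have hcomp := hT.comp_eq (x := p) (N := N) fun r hr => hh2 _ (hZ r hr)
  have hTp : T.fixPt [o] = p := by
    refine (T.eq_fixPt (by simp) ?_).symm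
    rw [hcomp [o] (by simp)]
    exact S.comp_fixPt (by simp)
  have hcompx : ∀ r : List (Fin m), r.length ≤ M + s.length + 1 → T.comp r x = S.comp r x :=
    fun r hr => by
      have h1 := hcomp (r ++ w) (by rw [List.length_append]; omega)
      rwa [comp_append, comp_append, hcomp w (by omega)] at h1
  have hTz : T.comp s x = z := hcompx s (by omega)
  have hcompz : ∀ r : List (Fin m), r.length ≤ M + 1 → T.comp r z = S.comp r z := fun r hr => by
    have h1 := hcompx (r ++ s) (by rw [List.length_append]; omega)
    rwa [comp_append, comp_append, hTz] at h1
  have hmem : ∀ r : List (Fin m), r.length ≤ M → (S.comp r z : ℝ) ∈ Z := fun r hr => by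
    have h1 := hZ (r ++ (s ++ w)) (by simp only [List.length_append]; omega)
    rwa [comp_append, comp_append] at h1
  have hdne : ∀ (k : Fin m) (r : List (Fin m)), r.length ≤ M → r ≠ [] →
      T.mapDeriv k (S.comp r z) = S.mapDeriv k (S.comp r z) := fun k r hr hr0 => by
    by_cases hk : k = i
    · subst hk
      rw [hT.mapDeriv_eq (hh.differentiable two_ne_zero),
        hh3 _ (hmem r hr) fun h => hw r hr0 hr (Subtype.ext h), mul_zero, add_zero]
    · exact hT.mapDeriv_eq_of_ne hk _
  -- Beyond `z` the paths never meet `z` again, so they do not see the change of the derivative.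
  have hcong : ∀ (k : Fin m) (r : List (Fin m)), r.length + 1 ≤ M →
      T.compDeriv r (S.map k z) = S.compDeriv r (S.map k z) := fun k r hr => by
    have h1 : T.map k z = S.map k z := hcompz [k] (by simp)
    refine compDeriv_congr (fun q hq => ?_) fun n q hq => ?_
    · have h2 := hcompz (q ++ [k]) (by have := hq.length_le; simp; omega)
      rwa [comp_append, comp_append, comp_singleton, comp_singleton, h1] at h2
    · have h2 := hdne n (q ++ [k]) (by have := hq.length_le; simp at this ⊢; omega) (by simp)
      rwa [comp_append, comp_singleton] at h2
  -- The derivatives of the two compositions agree; the common factor from the suffix `s` cancels.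
  have hE : ∀ G ∈ O, G.comp w (G.fixPt [o]) = x → G.comp s x = z →
      G.compDeriv u (G.map i z) * G.mapDeriv i z = G.compDeriv v (G.map j z) * G.mapDeriv j z := by
    intro G hG hGx hGz
    have h1 := compDeriv_eq_of_comp_eq (hreg G hG) (H G hG) w
    rw [hGx, compDeriv_append, compDeriv_append, compDeriv, compDeriv, comp_cons, comp_cons, hGz,
      ← mul_assoc, ← mul_assoc] at h1
    exact mul_right_cancel₀ (G.compDeriv_ne_zero s x) h1
  have hES := hE S hSO rfl rfl
  have hET := hE T hTO (by rw [hTp]; exact hcomp w (by omega)) hTz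
  have hi : T.map i z = S.map i z := hcompz [i] (by simp)
  have hj : T.map j z = S.map j z := hcompz [j] (by simp)
  rw [hi, hj, hcong i u (by omega), hcong j v (by omega), hT.mapDeriv_eq_of_ne hij.symm, ← hES,
    hT.mapDeriv_eq (hh.differentiable two_ne_zero)] at hET
  have h1 := mul_left_cancel₀ (S.compDeriv_ne_zero u _) hET
  have h2 : t * deriv h z = 0 := by linarith
  exact mul_ne_zero ht.ne' hh1 h2

/-- The elements for which `S_u` and `S_v` agree at the images of the fixed point of the map `o`,
a closed set that contains all elements with `S_u = S_v` on the attractor. -/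
def agreeSet (o : Fin m) (u v : List (Fin m)) : Set (Theta a b α β ρ m) :=
  {S | ∀ w, S.comp u (S.comp w (S.fixPt [o])) = S.comp v (S.comp w (S.fixPt [o]))}

theorem isClosed_agreeSet (o : Fin m) (u v : List (Fin m)) :
    IsClosed (agreeSet o u v : Set (Theta a b α β ρ m)) := by
  simp only [agreeSet, ← comp_append, ofPred_forall]
  exact isClosed_iInter fun w => isClosed_eq (continuous_comp_fixPt _ (by simp))
    (continuous_comp_fixPt _ (by simp))

theorem not_comp_eq_of_suffix {S : Theta a b α β ρ m} {o l : Fin m}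
    (hol : S.fixPt [o] ≠ S.fixPt [l]) {s t : List (Fin m)} (ht : t ≠ []) :
    ¬ ∀ w, S.comp (t ++ s) (S.comp w (S.fixPt [o])) = S.comp s (S.comp w (S.fixPt [o])) := by
  intro h
  have h1 := h []
  have h2 := h [l]
  rw [comp_append] at h1 h2
  exact map_fixPt_ne hol (S.comp_injective s (S.eq_of_fixed ht h2 h1))

theorem isNowhereDense_agreeSet {o l : Fin m} (hol : o ≠ l) {u v : List (Fin m)} (huv : u ≠ v) :
    IsNowhereDense (agreeSet o u v : Set (Theta a b α β ρ m)) := by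
  rw [(isClosed_agreeSet o u v).isNowhereDense_iff]
  by_contra hne
  obtain ⟨O, hOsub, hO, ⟨S, hS⟩, hreg⟩ := exists_open_regular hol isOpen_interior
    (nonempty_iff_ne_empty.2 hne)
  have hagree : ∀ T ∈ O, T ∈ agreeSet o u v := fun T hT => interior_subset (hOsub hT)
  obtain ⟨hfix, η, hη, hSη⟩ := hreg S hS
  obtain ⟨s, ⟨u', v', i, j, hij, rfl, rfl⟩ | ⟨t, ht, rfl, rfl⟩ | ⟨t, ht, rfl, rfl⟩⟩ :=
    exists_common_suffix huv
  · obtain ⟨T, hT, w, hTw⟩ := exists_comp_ne_of_letter_ne hO hS hη hSη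
      (fun T hT => (hreg T hT).1) (u := u') (v := v') (s := s) hij
    exact hTw (hagree T hT w)
  · exact not_comp_eq_of_suffix hfix ht (hagree S hS)
  · exact not_comp_eq_of_suffix hfix ht fun w => (hagree S hS w).symm

theorem mem_agreeSet_of_eqOn (hm : 1 ≤ m) {S : Theta a b α β ρ m} (o : Fin m)
    {u v : List (Fin m)} (h : EqOn (S.comp u) (S.comp v) S.attractor) : S ∈ agreeSet o u v :=
  fun w => h ((S.isAttractor hm).comp_mem w ((S.isAttractor hm).fixPt_mem (by simp)))

end Overlap

end Theta

/-! ### Common fixed points when strong separation fails -/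

/-- The word `b k, b (k + 1), …, b (k + n - 1)`. -/
def segment {ι : Type*} (b : ℕ → ι) : ℕ → ℕ → List ι
  | _, 0 => []
  | k, n + 1 => b k :: segment b (k + 1) n

namespace Theta

variable {a b α β ρ : ℝ} {m : ℕ}

/-- The points `z k` form a backward orbit of `z 0` with letters `e k`; in other words `z k` is the
point of the attractor coded by `e k, e (k + 1), …`. -/
def IsBackwardOrbit (S : Theta a b α β ρ m) (e : ℕ → Fin m) (z : ℕ → Icc a b) : Prop :=
  ∀ k, S.map (e k) (z (k + 1)) = z k

/-- A point of the attractor has a backward orbit that uses a prescribed letter `i` whenever it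
visits a given point `y` of the `i`-th piece. -/
theorem exists_isBackwardOrbit {S : Theta a b α β ρ m} {L : Set (Icc a b)} (hL : S.IsAttractor L)
    {i : Fin m} {y : Icc a b} (hy : y ∈ S.map i '' L) {x : Icc a b} (hx : x ∈ L) :
    ∃ e z, S.IsBackwardOrbit e z ∧ z 0 = x ∧ ∀ k, z k = y → e k = i := by
  have hstep : ∀ x : L, ∃ k : Fin m, ∃ x' : L, S.map k x' = x ∧ ((x : Icc a b) = y → k = i) := by
    rintro ⟨x, hx⟩
    by_cases hxy : x = y
    · obtain ⟨x', hx', hxx'⟩ := hy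
      exact ⟨i, ⟨x', hx'⟩, hxx'.trans hxy.symm, fun _ => rfl⟩
    · rw [hL.2.2] at hx
      obtain ⟨k, x', hx', hxx'⟩ := mem_iUnion.1 hx
      exact ⟨k, ⟨x', hx'⟩, hxx', fun h => absurd h hxy⟩
  choose f g hfg hf using hstep
  set z : ℕ → L := fun k => g^[k] ⟨x, hx⟩ with hz
  refine ⟨fun k => f (z k), fun k => z k, fun k => ?_, rfl, fun k => hf (z k)⟩
  have h1 : z (k + 1) = g (z k) := Function.iterate_succ_apply' g k _
  change S.map (f (z k)) (z (k + 1)) = z k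
  rw [h1, hfg]

theorem abs_map_sub_map_le (S : Theta a b α β ρ m) (i : Fin m) (x y : Icc a b) :
    |(S.map i x : ℝ) - S.map i y| ≤ ρ * |(x : ℝ) - y| := S.dist_map_le i x y

section Tracking

variable [hA : Admissible a b α β ρ]

/-- Perturbed orbits along the letters of a backward orbit stay close to that orbit. -/
theorem IsPerturbation.abs_comp_segment_sub_le {S T : Theta a b α β ρ m} {j : Fin m} {h : ℝ → ℝ}
    {t : ℝ} (hT : S.IsPerturbation j h t T) (hh : ∀ s, |h s| ≤ 1) {e : ℕ → Fin m}
    {z : ℕ → Icc a b} (hz : S.IsBackwardOrbit e z) (p : Icc a b) (n k : ℕ) :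
    |(T.comp (segment e k n) p : ℝ) - z k| ≤ |t| / (1 - ρ) + ρ ^ n * (b - a) := by
  have hρ : 0 < 1 - ρ := sub_pos.2 hA.rho_lt_one
  induction n generalizing k with
  | zero =>
    have h1 : |(p : ℝ) - z k| ≤ b - a := dist_le_length p (z k)
    have h2 : 0 ≤ |t| / (1 - ρ) := by positivity
    simp only [segment, comp, id, pow_zero, one_mul]
    linarith
  | succ n ih =>
    set x := T.comp (segment e (k + 1) n) p with hx
    have h1 : T.comp (segment e k (n + 1)) p = T.map (e k) x := rfl
    have h2 : |(T.map (e k) x : ℝ) - S.map (e k) x| ≤ |t| := by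
      by_cases hk : e k = j
      · rw [hk, hT.1, add_sub_cancel_left, abs_mul]
        exact mul_le_of_le_one_right (abs_nonneg t) (hh _)
      · rw [hT.2 _ hk, sub_self, abs_zero]
        exact abs_nonneg t
    have h3 := (S.abs_map_sub_map_le (e k) x (z (k + 1))).trans
      (mul_le_mul_of_nonneg_left (ih (k + 1)) hA.rho_pos.le)
    rw [hz k] at h3
    rw [h1]
    refine (abs_sub_le _ (S.map (e k) x : ℝ) _).trans ((add_le_add h2 h3).trans (le_of_eq ?_))
    rw [pow_succ]
    field_simp
    ring

/-- While the backward orbit avoids the support of the perturbation, the error contracts. -/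
theorem IsPerturbation.abs_comp_segment_sub_le_of_far {S T : Theta a b α β ρ m} {j : Fin m}
    {h : ℝ → ℝ} {t : ℝ} (hT : S.IsPerturbation j h t T) (hh : ∀ s, |h s| ≤ 1) {e : ℕ → Fin m}
    {z : ℕ → Icc a b} (hz : S.IsBackwardOrbit e z) (p : Icc a b) {c δ : ℝ}
    (hδ : ∀ s, δ ≤ |s - c| → h s = 0) {l : ℕ} (hl : |t| / (1 - ρ) + ρ ^ l * (b - a) ≤ δ)
    (K k : ℕ) (hfar : ∀ n < K, e (k + n) = j → 2 * δ ≤ |(z (k + n + 1) : ℝ) - c|) :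
    |(T.comp (segment e k (K + l)) p : ℝ) - z k| ≤
      ρ ^ K * (|t| / (1 - ρ) + ρ ^ l * (b - a)) := by
  induction K generalizing k with
  | zero =>
    rw [zero_add, pow_zero, one_mul]
    exact hT.abs_comp_segment_sub_le hh hz p l k
  | succ K ih =>
    have hK : K + 1 + l = (K + l) + 1 := by omega
    set x := T.comp (segment e (k + 1) (K + l)) p with hx
    have h1 : T.comp (segment e k (K + 1 + l)) p = T.map (e k) x := by rw [hK]; rfl
    have h2 := ih (k + 1) fun n hn he => by
      have := hfar (n + 1) (by omega)
      rw [show k + (n + 1) = k + 1 + n by omega] at this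
      exact this he
    have h3 : T.map (e k) x = S.map (e k) x := by
      by_cases hk : e k = j
      · have h4 := hfar 0 (by omega) hk
        have h5 : |(x : ℝ) - z (k + 1)| ≤ δ := by
          refine (h2.trans (mul_le_of_le_one_left ?_ ?_)).trans hl
          · have := sub_pos.2 hA.lt
            have := sub_pos.2 hA.rho_lt_one
            have := hA.rho_pos
            positivity
          · exact pow_le_one₀ hA.rho_pos.le hA.rho_lt_one.le
        refine Subtype.ext ?_
        rw [hk, hT.1, hδ x, mul_zero, add_zero]
        have h6 := abs_sub_le (z (k + 1) : ℝ) x c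
        rw [abs_sub_comm (z (k + 1) : ℝ) x] at h6
        rw [add_zero] at h4
        linarith
      · rw [hT.2 _ hk]
    rw [h1, h3, ← hz k, pow_succ', mul_assoc]
    exact (S.abs_map_sub_map_le _ _ _).trans (mul_le_mul_of_nonneg_left h2 hA.rho_pos.le)

/-- Let `e` and `e'` be codings of the same point `z 0 = z' 0`, such that the step
`z 1 ↦ z 0` by the letter `e 0` occurs nowhere else in the two backward orbits. A bump at `z 1`
added to the map `e 0` moves the point coded by `e` relative to the one coded by `e'`, in the
direction of the sign of the parameter. The intermediate value theorem, applied to the fixed points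
of long initial words of the two codings, produces a common fixed point. -/
theorem exists_common_fixPt {O : Set (Theta a b α β ρ m)} (hO : IsOpen O)
    {S : Theta a b α β ρ m} (hSO : S ∈ O) {η : ℝ} (hη : 0 < η) (hS : S.Margin η)
    {e e' : ℕ → Fin m} {z z' : ℕ → Icc a b} (hz : S.IsBackwardOrbit e z)
    (hz' : S.IsBackwardOrbit e' z') (h0 : z' 0 = z 0) (hne : e' 0 ≠ e 0)
    (he : ∀ k, e (k + 1) = e 0 → z (k + 2) ≠ z 1) (he' : ∀ k, e' k = e 0 → z' (k + 1) ≠ z 1) :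
    ∃ T ∈ O, ∃ i j u v, i ≠ j ∧ T.fixPt (i :: u) = T.fixPt (j :: v) := by
  have hρ : 0 < 1 - ρ := sub_pos.2 hA.rho_lt_one
  have hρ0 := hA.rho_pos
  have hab : 0 < b - a := sub_pos.2 hA.lt
  set C := 1 / (1 - ρ) + 1 with hC
  have hC0 : 0 < C := by positivity
  -- After `K` steps the error has become negligible.
  obtain ⟨K, hK⟩ : ∃ K : ℕ, ρ ^ (K + 1) * C ≤ 1 / 4 := by
    obtain ⟨K, hK⟩ := hA.exists_pow_mul_le (ρ * C) (by norm_num : (0 : ℝ) < 1 / 4)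
    exact ⟨K, by rwa [pow_succ, mul_assoc]⟩
  obtain ⟨δ, hδ0, hδ⟩ : ∃ δ > 0, ∀ k < K + 1,
      (e (k + 1) = e 0 → 2 * δ ≤ |(z (k + 2) : ℝ) - z 1|) ∧
      (e' k = e 0 → 2 * δ ≤ |(z' (k + 1) : ℝ) - z 1|) := by
    have h1 : ∀ k, ∀ᶠ δ in 𝓝[>] (0 : ℝ), (e (k + 1) = e 0 → 2 * δ ≤ |(z (k + 2) : ℝ) - z 1|) ∧
        (e' k = e 0 → 2 * δ ≤ |(z' (k + 1) : ℝ) - z 1|) := fun k => by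
      have h2 : ∀ x : Icc a b, x ≠ z 1 → ∀ᶠ δ in 𝓝[>] (0 : ℝ), 2 * δ ≤ |(x : ℝ) - z 1| :=
        fun x hx => by
          have h3 : 0 < |(x : ℝ) - z 1| := abs_pos.2 (sub_ne_zero.2 fun h => hx (Subtype.ext h))
          filter_upwards [nhdsWithin_le_nhds (ge_mem_nhds (half_pos h3))] with δ hδ
          linarith
      exact (eventually_imp_distrib_left.2 fun h => h2 _ (he k h)).and
        (eventually_imp_distrib_left.2 fun h => h2 _ (he' k h))
    have h4 : ∀ᶠ δ in 𝓝[>] (0 : ℝ), ∀ k ∈ Finset.range (K + 1),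
        (e (k + 1) = e 0 → 2 * δ ≤ |(z (k + 2) : ℝ) - z 1|) ∧
        (e' k = e 0 → 2 * δ ≤ |(z' (k + 1) : ℝ) - z 1|) :=
      (Finset.eventually_all _).2 fun k _ => h1 k
    obtain ⟨δ, hδ, hδ0⟩ := (h4.and self_mem_nhdsWithin).exists
    exact ⟨δ, hδ0, fun k hk => hδ k (Finset.mem_range.2 hk)⟩
  let h : ContDiffBump (z 1 : ℝ) := ⟨δ / 2, δ, half_pos hδ0, half_lt_self hδ0⟩
  have hh1 : ∀ s, |h s| ≤ 1 := fun s => by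
    rw [abs_of_nonneg h.nonneg]
    exact h.le_one
  have hhz : ∀ s : ℝ, δ ≤ |s - z 1| → h s = 0 := fun s hs => h.zero_of_le_dist hs
  obtain ⟨t₁, ht₁, hpert⟩ := exists_isPerturbation_mem hO hSO hη hS (e 0) (h := h) h.contDiff
  set t₀ := min t₁ (δ / (2 * C)) with ht₀
  have ht₀0 : 0 < t₀ := lt_min ht₁ (by positivity)
  have htC : C * t₀ ≤ δ / 2 := by
    have h1 : t₀ ≤ δ / (2 * C) := min_le_right _ _
    rw [le_div_iff₀ (by positivity)] at h1
    linarith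
  have hne_theta : Nonempty (Theta a b α β ρ m) := ⟨S⟩
  choose! γ hγO hγ using fun t (ht : |t| ≤ t₀) => hpert t (ht.trans (min_le_left _ _))
  obtain ⟨l, hl⟩ := hA.exists_pow_mul_le (b - a) ht₀0
  set U := segment e 0 (K + 1 + l + 1) with hU
  set V := segment e' 0 (K + 1 + l) with hV
  have hUc : U = e 0 :: segment e 1 (K + 1 + l) := rfl
  have hVc : V = e' 0 :: segment e' 1 (K + l) := by
    rw [hV, show K + 1 + l = (K + l) + 1 by omega]
    rfl
  have hU0 : U ≠ [] := by rw [hUc]; simp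
  have hV0 : V ≠ [] := by rw [hVc]; simp
  -- At the end points of the parameter interval the displacement is controlled.
  have hend : ∀ t, |t| = t₀ → |((γ t).fixPt U : ℝ) - z 0 - t| ≤ t₀ / 4 ∧
      |((γ t).fixPt V : ℝ) - z 0| ≤ t₀ / 4 := by
    intro t ht
    have hT := hγ t ht.le
    have hD : |t| / (1 - ρ) + ρ ^ l * (b - a) ≤ C * t₀ := by
      rw [ht, hC, add_mul, one_mul, one_div, inv_mul_eq_div]
      linarith
    have hDδ : |t| / (1 - ρ) + ρ ^ l * (b - a) ≤ δ := by linarith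
    have hD4 : ρ ^ (K + 1) * (|t| / (1 - ρ) + ρ ^ l * (b - a)) ≤ t₀ / 4 := by
      refine (mul_le_mul_of_nonneg_left hD (by positivity)).trans ?_
      rw [← mul_assoc]
      linarith [mul_le_mul_of_nonneg_right hK ht₀0.le]
    constructor
    · set p := (γ t).fixPt U
      have h1 := (hT.abs_comp_segment_sub_le_of_far hh1 hz p hhz hDδ (K + 1) 1 fun n hn hen => by
        rw [add_comm 1 n] at hen ⊢
        exact (hδ n hn).1 hen).trans hD4
      set x := (γ t).comp (segment e 1 (K + 1 + l)) p
      have h2 : p = (γ t).map (e 0) x := ((γ t).comp_fixPt hU0).symm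
      have h3 : h x = 1 := h.one_of_mem_closedBall <| by
        rw [Metric.mem_closedBall, Real.dist_eq]
        have h5 : 1 ≤ C := by
          rw [hC]
          linarith [show 0 < 1 / (1 - ρ) by positivity]
        have h6 : t₀ ≤ C * t₀ := le_mul_of_one_le_left ht₀0.le h5
        change _ ≤ δ / 2
        linarith
      rw [h2, hT.1, h3, mul_one, ← hz 0]
      have h4 := S.abs_map_sub_map_le (e 0) x (z 1)
      rw [show (S.map (e 0) x : ℝ) + t - S.map (e 0) (z (0 + 1)) - t =
        S.map (e 0) x - S.map (e 0) (z 1) by simp; ring]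
      refine h4.trans ((mul_le_of_le_one_left (abs_nonneg _) hA.rho_lt_one.le).trans h1)
    · set p := (γ t).fixPt V with hp
      have h1 := (hT.abs_comp_segment_sub_le_of_far hh1 hz' p hhz hDδ (K + 1) 0 fun n hn hen => by
        rw [zero_add] at hen ⊢
        exact (hδ n hn).2 hen).trans hD4
      rw [← hV, hp, (γ t).comp_fixPt hV0, h0] at h1
      exact h1
  have hcont : ContinuousOn γ (Icc (-t₀) t₀) := by
    intro s hs
    refine tendsto_iff_dist_tendsto_zero.2 ?_
    have h1 : Tendsto (fun t : ℝ => |t - s| * holderNorm α fun x : Icc a b => h x)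
        (𝓝[Icc (-t₀) t₀] s) (𝓝 0) := by
      have h2 : Continuous fun t : ℝ => |t - s| * holderNorm α fun x : Icc a b => h x := by fun_prop
      have h3 := h2.tendsto s
      rw [sub_self, abs_zero, zero_mul] at h3
      exact h3.mono_left nhdsWithin_le_nhds
    refine squeeze_zero' (Eventually.of_forall fun _ => dist_nonneg) ?_ h1
    filter_upwards [self_mem_nhdsWithin] with t ht
    exact (hγ t (abs_le.2 ht)).dist_le (hγ s (abs_le.2 hs))
  set f : ℝ → ℝ := fun t => (γ t).fixPt U - (γ t).fixPt V with hfdef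
  have hf : ContinuousOn f (Icc (-t₀) t₀) :=
    (continuous_subtype_val.comp_continuousOn ((continuous_fixPt hU0).comp_continuousOn hcont)).sub
      (continuous_subtype_val.comp_continuousOn ((continuous_fixPt hV0).comp_continuousOn hcont))
  have h0f : (0 : ℝ) ∈ Icc (f (-t₀)) (f t₀) := by
    have h1 := hend t₀ (abs_of_pos ht₀0)
    have h2 := hend (-t₀) (by rw [abs_neg, abs_of_pos ht₀0])
    have h3 := abs_le.1 h1.1
    have h4 := abs_le.1 h1.2
    have h5 := abs_le.1 h2.1
    have h6 := abs_le.1 h2.2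
    simp only [hfdef]
    constructor <;> linarith
  obtain ⟨t, ht, htf⟩ := intermediate_value_Icc (by linarith) hf h0f
  refine ⟨γ t, hγO t (abs_le.2 ht), e 0, e' 0, segment e 1 (K + 1 + l),
    segment e' 1 (K + l), hne.symm, ?_⟩
  rw [← hUc, ← hVc]
  exact Subtype.ext (sub_eq_zero.1 htf)

/-- If the strong separation property fails, then arbitrarily small perturbations produce two words
with different first letters and a common fixed point. -/
theorem exists_common_fixPt_of_not_SSP (hm : 1 ≤ m) {O : Set (Theta a b α β ρ m)} (hO : IsOpen O)
    {S : Theta a b α β ρ m} (hSO : S ∈ O) {η : ℝ} (hη : 0 < η) (hS : S.Margin η)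
    (hssp : ¬ S.SSP) : ∃ T ∈ O, ∃ i j u v, i ≠ j ∧ T.fixPt (i :: u) = T.fixPt (j :: v) := by
  have hL := S.isAttractor hm
  unfold SSP at hssp
  push Not at hssp
  obtain ⟨i, j, hij, y, hyi, hyj⟩ := hssp
  have hyL : y ∈ S.attractor := by
    rw [hL.2.2]
    exact mem_iUnion.2 ⟨i, hyi⟩
  -- Both backward orbits use the letter `i` at every visit to `y`, except for the very first
  -- step of the second one. So the step by `j` onto `y` is taken only once.
  obtain ⟨e', z', hz', hz'0, he'⟩ := exists_isBackwardOrbit hL hyi hyL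
  obtain ⟨x, hx, hxy⟩ := hyj
  obtain ⟨e, z, hz, hz0, he⟩ := exists_isBackwardOrbit hL hyi hx
  refine exists_common_fixPt hO hSO hη hS (e := fun k => Nat.casesOn k j e)
    (z := fun k => Nat.casesOn k y z) (e' := e') (z' := z') (fun k => ?_) hz' hz'0
    (fun h => hij ((he' 0 hz'0).symm.trans h)) (fun k hk hzk => ?_) (fun k hk hzk => ?_)
  · cases k with
    | zero => exact (congrArg (S.map j) hz0).trans hxy
    | succ k => exact hz k
  · change e k = j at hk
    change z (k + 1) = z 0 at hzk
    have h1 := hz k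
    rw [hzk, hk, hz0, hxy] at h1
    exact hij ((he k h1.symm).symm.trans hk)
  · change e' k = j at hk
    change z' (k + 1) = z 0 at hzk
    have h1 := hz' k
    rw [hzk, hk, hz0, hxy] at h1
    exact hij ((he' k h1.symm).symm.trans hk)

end Tracking

end Theta

/-! ### Counting words -/

/-- The word `w` repeated `k` times. -/
def wordPow {ι : Type*} (w : List ι) (k : ℕ) : List ι := (List.replicate k w).flatten

theorem wordPow_add {ι : Type*} (w : List ι) (k l : ℕ) :
    wordPow w (k + l) = wordPow w k ++ wordPow w l := by
  simp only [wordPow, List.replicate_add, List.flatten_append]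

theorem wordPow_succ {ι : Type*} (w : List ι) (k : ℕ) :
    wordPow w (k + 1) = w ++ wordPow w k := by
  simp only [wordPow, List.replicate_succ, List.flatten_cons]

theorem length_wordPow {ι : Type*} (w : List ι) (k : ℕ) :
    (wordPow w k).length = k * w.length := by
  simp [wordPow]

theorem eq_of_prefix_of_prefix {ι : Type*} {w s x y : List ι} {i j : ι} (h : s.length < w.length)
    (hi : w <+: s ++ i :: x) (hj : w <+: s ++ j :: y) : i = j := by
  obtain ⟨t, ht⟩ := hi
  obtain ⟨t', ht'⟩ := hj
  have h1 := congrArg (fun l => l[s.length]?) ht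
  have h2 := congrArg (fun l => l[s.length]?) ht'
  simp only [List.getElem?_append_left h, List.getElem?_append_right le_rfl, Nat.sub_self,
    List.getElem?_cons_zero] at h1 h2
  exact Option.some_injective _ (h1.symm.trans h2)

namespace Theta

variable {a b α β ρ : ℝ} {m : ℕ}

theorem comp_wordPow_of_fixed {S : Theta a b α β ρ m} {w : List (Fin m)} {p : Icc a b}
    (h : S.comp w p = p) (k : ℕ) : S.comp (wordPow w k) p = p := by
  induction k with
  | zero => rfl
  | succ k ih => rw [wordPow_succ, comp_append, ih, h]

/-- The initial segment of a word at the scale `r`. -/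
theorem exists_prefix_at_scale (S : Theta a b α β ρ m) {L : Set (Icc a b)} {r : ℝ}
    (h0 : r < Metric.diam (S.comp [] '' L)) (w : List (Fin m))
    (hw : Metric.diam (S.comp w '' L) ≤ r) : ∃ v, v <+: w ∧ v ≠ [] ∧
      Metric.diam (S.comp v '' L) ≤ r ∧ r < Metric.diam (S.comp v.dropLast '' L) := by
  induction w using List.reverseRecOn with
  | nil => exact absurd hw (not_le.2 h0)
  | append_singleton w i ih =>
    by_cases h : Metric.diam (S.comp w '' L) ≤ r
    · obtain ⟨v, hv, hv'⟩ := ih h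
      exact ⟨v, hv.trans (List.prefix_append _ _), hv'⟩
    · exact ⟨w ++ [i], List.prefix_refl _, by simp, hw, by simpa using h⟩

/-- The elements that have, for some `x` in the attractor and some `r > 0`, at least `n` words of
scale `r` whose pieces meet the ball `B(x, r)`. The words are counted, not the maps `S_w`. -/
def manyWords (n : ℕ) : Set (Theta a b α β ρ m) :=
  {S | ∃ x ∈ S.attractor, ∃ r > 0, ∃ w : Fin n → List (Fin m), Function.Injective w ∧
    ∀ q, w q ≠ [] ∧ Metric.diam (S.comp (w q) '' S.attractor) ≤ r ∧
      r < Metric.diam (S.comp (w q).dropLast '' S.attractor) ∧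
      ((S.comp (w q) '' S.attractor) ∩ Metric.ball x r).Nonempty}

/-- In the absence of exact overlaps, different words give different maps. -/
theorem hasExactOverlap_of_WSP {S : Theta a b α β ρ m} (hS : S.WSP)
    (hmany : ∀ n, S ∈ manyWords n) : S.HasExactOverlap := by
  obtain ⟨N, hN⟩ := hS
  obtain ⟨x, hx, r, hr, w, hw, hwr⟩ := hmany (N + 1)
  by_contra hno
  have hinj : Function.Injective fun q => S.attractor.domRestrict (S.comp (w q)) := by
    intro q q' h
    by_contra hne
    refine hno ⟨w q, w q', (hwr q).1, (hwr q').1, hw.ne hne, fun y hy => ?_⟩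
    exact congrFun h ⟨y, hy⟩
  have hsub : range (fun q => S.attractor.domRestrict (S.comp (w q))) ⊆ S.Phi x r := by
    rintro _ ⟨q, rfl⟩
    exact ⟨w q, (hwr q).1, rfl, (hwr q).2⟩
  have h1 := (encard_le_encard hsub).trans (hN x hx r hr)
  rw [← image_univ, hinj.encard_image, encard_univ] at h1
  simp only [ENat.card_eq_coe_fintype_card, Fintype.card_fin] at h1
  exact absurd (Nat.cast_le.1 h1) (by omega)

section Words

variable [hA : Admissible a b α β ρ]

/-- If `S_{iu}` and `S_{jv}`, `i ≠ j`, have a common fixed point, then all words in `iu` and `jv`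
code this point. There are many of them at every small scale, also after a perturbation. -/
theorem manyWords_mem_nhds (hm : 1 ≤ m) {S : Theta a b α β ρ m} {o l : Fin m}
    (hol : S.fixPt [o] ≠ S.fixPt [l]) {i j : Fin m} (hij : i ≠ j) {u v : List (Fin m)}
    (huv : S.fixPt (i :: u) = S.fixPt (j :: v)) (n : ℕ) : manyWords n ∈ 𝓝 S := by
  have hρ0 := hA.rho_pos
  have hβ := hA.beta_pos
  have hβ1 : β ≤ 1 := (hA.beta_lt_rho.trans hA.rho_lt_one).le
  have hab : 0 < b - a := sub_pos.2 hA.lt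
  set U := i :: u with hU
  set V := j :: v with hV
  have hU0 : U ≠ [] := by simp [hU]
  have hV0 : V ≠ [] := by simp [hV]
  set c := dist (S.fixPt [o]) (S.fixPt [l]) with hc
  have hc0 : 0 < c := dist_pos.2 hol
  set N := n * U.length with hN
  set r := β ^ N * (c / 2) with hr
  have hr0 : 0 < r := by positivity
  obtain ⟨L, hL⟩ := hA.exists_pow_mul_le (b - a) hr0
  -- The words `U ^ q V ^ (L + 1)` fix the common fixed point and differ before the position `N`.
  set ζ : ℕ → List (Fin m) := fun q => wordPow U q ++ wordPow V (L + 1) with hζ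
  have hζL : ∀ q, L ≤ (ζ q).length := fun q => by
    have h1 : 1 ≤ V.length := by simp [hV]
    simp only [hζ, List.length_append, length_wordPow]
    nlinarith
  have hζS : ∀ q, S.comp (ζ q) (S.fixPt U) = S.fixPt U := fun q => by
    simp only [hζ, comp_append]
    rw [huv, comp_wordPow_of_fixed (S.comp_fixPt hV0), ← huv,
      comp_wordPow_of_fixed (S.comp_fixPt hU0)]
  have hev1 : ∀ᶠ T in 𝓝 S, c / 2 < dist (T.fixPt [o]) (T.fixPt [l]) :=
    (((continuous_fixPt (by simp)).dist (continuous_fixPt (by simp))).tendsto S).eventually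
      (lt_mem_nhds (half_lt_self hc0))
  have hev2 : ∀ᶠ T in 𝓝 S, ∀ q : Fin n, dist (T.comp (ζ q) (T.fixPt U)) (T.fixPt U) < r := by
    refine eventually_all.2 fun q => ?_
    refine (((continuous_comp_fixPt (ζ q) hU0).dist (continuous_fixPt hU0)).tendsto S).eventually
      (gt_mem_nhds ?_)
    rw [hζS, dist_self]
    exact hr0
  filter_upwards [hev1, hev2] with T hT1 hT2
  have hatt := T.isAttractor hm
  -- The choice of `r` forces words of scale `r` to be longer than `N`.
  have hlong : ∀ w : List (Fin m), Metric.diam (T.comp w '' T.attractor) ≤ r → N < w.length := by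
    intro w hw
    by_contra! hwN
    have h1 := T.le_dist_comp w (T.fixPt [o]) (T.fixPt [l])
    have h2 := Metric.dist_le_diam_of_mem Metric.isBounded_of_compactSpace
      (mem_image_of_mem (T.comp w) (hatt.fixPt_mem (w := [o]) (by simp)))
      (mem_image_of_mem (T.comp w) (hatt.fixPt_mem (w := [l]) (by simp)))
    have h3 : β ^ N ≤ β ^ w.length := pow_le_pow_of_le_one hβ.le hβ1 hwN
    have h4 : r < β ^ w.length * dist (T.fixPt [o]) (T.fixPt [l]) :=
      mul_lt_mul' h3 hT1 (by positivity) (by positivity)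
    linarith
  have hζd : ∀ q, Metric.diam (T.comp (ζ q) '' T.attractor) ≤ r := fun q => by
    refine Metric.diam_le_of_forall_dist_le hr0.le ?_
    rintro _ ⟨x, -, rfl⟩ _ ⟨y, -, rfl⟩
    refine (T.dist_comp_le _ x y).trans (le_trans ?_ hL)
    exact mul_le_mul (pow_le_pow_of_le_one hρ0.le hA.rho_lt_one.le (hζL q)) (dist_le_length x y)
      dist_nonneg (by positivity)
  have hnil : r < Metric.diam (T.comp [] '' T.attractor) := by
    by_contra! h
    exact absurd (hlong [] h) (by simp)
  choose w hwζ hw0 hwr hrw using fun q => T.exists_prefix_at_scale hnil (ζ q) (hζd q)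
  have hne : ∀ q q' : Fin n, (q : ℕ) < q' → w q ≠ w q' := by
    intro q q' hqq' heq
    obtain ⟨d, hd⟩ := Nat.exists_eq_add_of_lt hqq'
    have h1 : ζ q = wordPow U q ++ j :: (v ++ wordPow V L) := by
      simp only [hζ, wordPow_succ V]
      rw [hV, List.cons_append]
    have h2 : ζ q' = wordPow U q ++ i :: (u ++ (wordPow U d ++ wordPow V (L + 1))) := by
      simp only [hζ]
      rw [hd, add_assoc, wordPow_add, wordPow_succ U, hU]
      simp only [List.cons_append, List.append_assoc]
    have h3 : (wordPow U q).length < (w q).length := by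
      rw [length_wordPow]
      exact (Nat.mul_le_mul_right _ q.2.le).trans_lt (hlong _ (hwr q))
    have h4 := hwζ q
    have h5 := hwζ q'
    rw [h1] at h4
    rw [← heq, h2] at h5
    exact hij (eq_of_prefix_of_prefix h3 h5 h4)
  refine ⟨T.fixPt U, hatt.fixPt_mem hU0, r, hr0, fun q => w q, fun q q' h => ?_,
    fun q => ⟨hw0 q, hwr q, hrw q, T.comp (ζ q) (T.fixPt U), ?_, hT2 q⟩⟩
  · rcases lt_trichotomy (q : ℕ) q' with h1 | h1 | h1
    · exact absurd h (hne q q' h1)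
    · exact Fin.ext h1
    · exact absurd h.symm (hne q' q h1)
  · obtain ⟨t, ht⟩ := hwζ q
    rw [← ht, comp_append]
    exact mem_image_of_mem _ (hatt.comp_mem t (hatt.fixPt_mem hU0))

theorem isNowhereDense_not_SSP_diff (hm : 1 ≤ m) {o l : Fin m} (hol : o ≠ l) (n : ℕ) :
    IsNowhereDense ({S : Theta a b α β ρ m | ¬ S.SSP} \ interior (manyWords n)) := by
  by_contra hne
  obtain ⟨O, hOsub, hO, hOne, hreg⟩ := exists_open_regular hol isOpen_interior
    (nonempty_iff_ne_empty.2 hne)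
  have hcl : O ⊆ closure ({S : Theta a b α β ρ m | ¬ S.SSP} \ interior (manyWords n)) :=
    hOsub.trans interior_subset
  obtain ⟨S₀, hS₀⟩ := hOne
  obtain ⟨S, hSO, hS, -⟩ := mem_closure_iff.1 (hcl hS₀) O hO hS₀
  obtain ⟨-, η, hη, hSη⟩ := hreg S hSO
  obtain ⟨T, hTO, i, j, u, v, hij, huv⟩ := exists_common_fixPt_of_not_SSP hm hO hSO hη hSη hS
  have hTW : T ∈ interior (manyWords n) :=
    mem_interior_iff_mem_nhds.2 (manyWords_mem_nhds hm (hreg T hTO).1 hij huv n)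
  obtain ⟨G, hG, -, hG'⟩ := mem_closure_iff.1 (hcl hTO) _ isOpen_interior hTW
  exact hG' hG

/-- For a generic element, either the strong separation property holds, or the weak separation
property fails and there are no exact overlaps. -/
theorem isMeagre_setOf_not_SSP_or (hm : 1 ≤ m) : IsMeagre {S : Theta a b α β ρ m |
    ¬ (S.SSP ∨ (¬ S.WSP ∧ ¬ S.HasExactOverlap))} := by
  rcases hm.eq_or_lt with rfl | hm2
  · -- With a single map the strong separation property holds trivially.
    refine IsMeagre.empty.mono fun S hS => hS (Or.inl fun i j hij => ?_)
    exact absurd (Subsingleton.elim i j) hij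
  obtain ⟨o, l, hol⟩ : ∃ o l : Fin m, o ≠ l :=
    ⟨⟨0, by omega⟩, ⟨1, hm2⟩, fun h => by simpa using congrArg Fin.val h⟩
  have hmeagre : IsMeagre ((⋃ p : {p : List (Fin m) × List (Fin m) // p.1 ≠ p.2},
      (agreeSet o p.1.1 p.1.2 : Set (Theta a b α β ρ m))) ∪
      ⋃ n, ({S : Theta a b α β ρ m | ¬ S.SSP} \ interior (manyWords n))) :=
    (isMeagre_iUnion fun p => (isNowhereDense_agreeSet hol p.2).isMeagre).union
      (isMeagre_iUnion fun n => (isNowhereDense_not_SSP_diff hm hol n).isMeagre)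
  refine hmeagre.mono fun S hS => ?_
  obtain ⟨hssp, hS⟩ := not_or.1 hS
  by_cases hE : S.HasExactOverlap
  · obtain ⟨u, v, -, -, huv, h⟩ := hE
    exact Or.inl (mem_iUnion.2 ⟨⟨(u, v), huv⟩, mem_agreeSet_of_eqOn hm o h⟩)
  · have hW : S.WSP := by
      by_contra hW
      exact hS ⟨hW, hE⟩
    refine Or.inr (mem_iUnion.2 ?_)
    by_contra! h
    refine hE (hasExactOverlap_of_WSP hW fun n => ?_)
    by_contra hn
    exact h n ⟨hssp, fun hi => hn (interior_subset hi)⟩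

end Words

end Theta
end SelfConformal

theorem mainTheorem1 (a b : ℝ) (hab : a < b) (α : ℝ) (hα : 0 < α) (hα1 : α ≤ 1)
    (m : ℕ) (hm : 1 ≤ m) (β ρ : ℝ) (hβ : 0 < β) (hβρ : β < ρ) (hρ : ρ < 1) :
    IsMeagre {S : SelfConformal.Theta a b α β ρ m |
      ¬ (S.SSP ∨ (¬ S.WSP ∧ ¬ S.HasExactOverlap))} := by
  have hA : SelfConformal.Admissible a b α β ρ := ⟨hab, hα, hα1, hβ, hβρ, hρ⟩
  exact SelfConformal.Theta.isMeagre_setOf_not_SSP_or hm
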